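/- A $3\times3$ semimagic square with magic sum $t$ is a $3\times 3$ array of pairwise distinct positive integers all of whose row sums and column sums equal $t$. For an integer $t>0$ let $S_a(t)$ be the number of such squares. A reduced semimagic square is defined in the same way, except that its entries are nonnegative and its smallest entry is $0$. Call a square $(x_{jk})$ normalized if $x_{11}$ is its smallest entry, $x_{11}<x_{12}<x_{13}$, $x_{11}<x_{21}<x_{31}$ and $x_{12}<x_{21}$. Let $r_a(s)$ be the number of reduced normalized semimagic squares with magic sum $s$. Then the following hold. (1) Generating function: \[ \sum_{t>0}S_a(t)x^t = 72\,\frac{x^3}{1-x^3}\sum_{s>0}r_a(s)x^s = \frac{72x^{15}\,P(x)}{(1-x^3)^2(1-x^4)(1-x^5)(1-x^6)(1-x^7)(1-x^8)}, \] where $P(x)=18x^{21}+5x^{20}+15x^{19}+11x^{17}-8x^{16}+x^{15}-23x^{14}-13x^{13}-22x^{12}-9x^{11}-16x^{10}+x^9-3x^8+7x^7+7x^6+9x^5+7x^4+6x^3+4x^2+2x+1$. (2) $S_a$ is a quasipolynomial of degree $4$ and period $840$. That is, there are polynomials $N_0,\dots,N_{839}$ with $S_a(t)=N_{t\bmod 840}(t)$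 for all $t>0$; no smaller positive integer in place of $840$ admits such a representation; and every constituent $N_r$ has degree $4$. (3) For every integer $t>0$, \[ S_a(t)=\tfrac18t^4-\tfrac92t^3+a_2(t)t^2-a_1(t)t+a_0(t)-72\,S_7(t), \] where $a_2(t)$ depends on $t$ modulo $6$ and is $\frac{243}{4}$ for $t\equiv0$, $\frac{218}{4}$ for $t\equiv1,5$, $\frac{227}{4}$ for $t\equiv2,4$, and $\frac{234}{4}$ for $t\equiv3$; $a_1(t)$ depends on $t$ modulo $12$ and is $\frac{1968}{5}$ for $t\equiv0$, $\frac{1158}{5}$ for $t\equiv1,5$, $\frac{1383}{5}$ for $t\equiv2,10$, $\frac{1653}{5}$ for $t\equiv3$, $\frac{1428}{5}$ for $t\equiv4,8$, $\frac{1923}{5}$ for $t\equiv6$, $\frac{1113}{5}$ for $t\equiv7,11$, and $\frac{1698}{5}$ for $t\equiv9$; \[ S_7(t)=\left\lfloor\frac{t-1}{21}\right\rfloor+\begin{cases}1,& t\equiv10,13,16,17,19,20 \pmod{21},\\ 0,&\text{otherwise;}\end{cases} \] and $a_0(t)$ depends on $t$ modulo $120$ and is given by the following table (the residue is the row label plus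 the column label). \[ \begin{array}{r|rrrrrrrrrr} &0&1&2&3&4&5&6&7&8&9\\ \hline 0&1224&\frac{7259}{40}&\frac{1801}{5}&\frac{23067}{40}&\frac{2452}{5}&\frac{2239}{8}&\frac{4653}{5}&\frac{5243}{40}&\frac{2224}{5}&\frac{31131}{40}\\ 10&413&\frac{539}{40}&\frac{5796}{5}&\frac{7547}{40}&\frac{1477}{5}&\frac{5823}{8}&\frac{2488}{5}&\frac{8603}{40}&\frac{4689}{5}&\frac{2651}{40}\\ 20&524&\frac{31419}{40}&\frac{1741}{5}&\frac{827}{40}&\frac{5832}{5}&\frac{2143}{8}&\frac{1513}{5}&\frac{26523}{40}&\frac{2164}{5}&\frac{8891}{40}\\ 30&1017&\frac{2939}{40}&\frac{2656}{5}&\frac{28827}{40}&\frac{1777}{5}&\frac{799}{8}&\frac{5508}{5}&\frac{11003}{40}&\frac{1189}{5}&\frac{26811}{40}\\ 40&584&\frac{6299}{40}&\frac{5121}{5}&\frac{347}{40}&\frac{2332}{5}&\frac{6975}{8}&\frac{1453}{5}&\frac{4283}{40}&\frac{5544}{5}&\frac{8411}{40}\\ 50&389&\frac{24219}{40}&\frac{2596}{5}&\frac{6587}{40}&\frac{4797}{5}&\frac{1279}{8}&\frac{2368}{5}&\frac{32283}{40}&\frac{1489}{5}&\frac{1691}{40}\\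 60&1188&\frac{8699}{40}&\frac{1621}{5}&\frac{24507}{40}&\frac{2632}{5}&\frac{1951}{8}&\frac{4833}{5}&\frac{3803}{40}&\frac{2044}{5}&\frac{32571}{40}\\ 70&377&\frac{1979}{40}&\frac{5976}{5}&\frac{6107}{40}&\frac{1657}{5}&\frac{5535}{8}&\frac{2308}{5}&\frac{10043}{40}&\frac{4509}{5}&\frac{4091}{40}\\ 80&560&\frac{29979}{40}&\frac{1921}{5}&-\frac{613}{40}&\frac{5652}{5}&\frac{2431}{8}&\frac{1333}{5}&\frac{27963}{40}&\frac{2344}{5}&\frac{7451}{40}\\ 90&1053&\frac{1499}{40}&\frac{2476}{5}&\frac{30267}{40}&\frac{1597}{5}&\frac{1087}{8}&\frac{5688}{5}&\frac{9563}{40}&\frac{1369}{5}&\frac{25371}{40}\\ 100&548&\frac{7739}{40}&\frac{4941}{5}&\frac{1787}{40}&\frac{2512}{5}&\frac{6687}{8}&\frac{1633}{5}&\frac{2843}{40}&\frac{5364}{5}&\frac{9851}{40}\\ 110&353&\frac{25659}{40}&\frac{2776}{5}&\frac{5147}{40}&\frac{4977}{5}&\frac{991}{8}&\frac{2188}{5}&\frac{33723}{40}&\frac{1309}{5}&\frac{3131}{40}\\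 \end{array} \] (4) The principal constituent is \[ N_0(t)=\tfrac18t^4-\tfrac92t^3+\tfrac{243}{4}t^2-\tfrac{13896}{35}t+1296 . \] -/

import Mathlib

open Polynomial

/-- A `3 × 3` square of natural numbers with pairwise distinct entries, all of whose row sums
and column sums equal `t`. -/
def HasDistinctEntriesAndLineSum (t : ℕ) (x : Matrix (Fin 3) (Fin 3) ℕ) : Prop :=
  (∀ i j k l, x i j = x k l → i = k ∧ j = l) ∧
  (∀ i, ∑ j, x i j = t) ∧
  (∀ j, ∑ i, x i j = t)

/-- A (strongly) semimagic square of order 3 with magic sum `t`: all entries are positive. -/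
def IsSemimagic (t : ℕ) (x : Matrix (Fin 3) (Fin 3) ℕ) : Prop :=
  (∀ i j, 0 < x i j) ∧ HasDistinctEntriesAndLineSum t x

/-- A reduced semimagic square of order 3 with magic sum `s`: the smallest entry is `0`. -/
def IsReducedSemimagic (s : ℕ) (x : Matrix (Fin 3) (Fin 3) ℕ) : Prop :=
  (∃ i j, x i j = 0) ∧ HasDistinctEntriesAndLineSum s x

/-- The normal form under row permutations, column permutations and transposition: the upper left
entry is the smallest, the first row and the first column increase, and `x₁₂ < x₂₁`. -/
def IsNormalized (x : Matrix (Fin 3) (Fin 3) ℕ) : Prop :=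
  (∀ i j, x 0 0 ≤ x i j) ∧
  (x 0 0 < x 0 1 ∧ x 0 1 < x 0 2) ∧
  (x 0 0 < x 1 0 ∧ x 1 0 < x 2 0) ∧
  x 0 1 < x 1 0

/-- `S_a(t)`: the number of `3 × 3` semimagic squares with magic sum `t`. -/
noncomputable def semimagicCount (t : ℕ) : ℕ :=
  {x : Matrix (Fin 3) (Fin 3) ℕ | IsSemimagic t x}.ncard

/-- `r_a(s)`: the number of reduced, normalized `3 × 3` semimagic squares with magic sum `s`. -/
noncomputable def reducedNormalCount (s : ℕ) : ℕ :=
  {x : Matrix (Fin 3) (Fin 3) ℕ | IsReducedSemimagic s x ∧ IsNormalized x}.ncard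

/-- The generating function `∑_{t > 0} f(t) x^t`. -/
noncomputable def genFun (f : ℕ → ℕ) : PowerSeries ℚ :=
  PowerSeries.mk fun t => if t = 0 then 0 else (f t : ℚ)

/-- `N 0, …, N (p - 1)` are constituents of the counting function `f` modulo `p`:
`f(t) = N_{t mod p}(t)` for all `t > 0`. -/
def AreConstituents (f : ℕ → ℕ) (p : ℕ) (N : ℕ → ℚ[X]) : Prop :=
  ∀ t : ℕ, 0 < t → (f t : ℚ) = (N (t % p)).eval (t : ℚ)

/-- `f` (on the positive integers) is a quasipolynomial whose period, the least possible number of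
constituents, is `p`. -/
def IsQuasipolynomialOfPeriod (f : ℕ → ℕ) (p : ℕ) : Prop :=
  IsLeast {q : ℕ | 0 < q ∧ ∃ N : ℕ → ℚ[X], AreConstituents f q N} p

/-- The coefficient `a₂(t)`, by the residue of `t` modulo 6. -/
def coeffA2 (t : ℕ) : ℚ :=
  match t % 6 with
  | 0 => 243 / 4
  | 1 | 5 => 218 / 4
  | 2 | 4 => 227 / 4
  | _ => 234 / 4

/-- The coefficient `a₁(t)`, by the residue of `t` modulo 12. -/
def coeffA1 (t : ℕ) : ℚ :=
  match t % 12 with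
  | 0 => 1968 / 5
  | 1 | 5 => 1158 / 5
  | 2 | 10 => 1383 / 5
  | 3 => 1653 / 5
  | 4 | 8 => 1428 / 5
  | 6 => 1923 / 5
  | 7 | 11 => 1113 / 5
  | _ => 1698 / 5

/-- The values of `a₀(t)` for `t = 0, 1, …, 119`, ten to a line. -/
def tableA0 : List ℚ :=
  [1224, 7259 / 40, 1801 / 5, 23067 / 40, 2452 / 5, 2239 / 8, 4653 / 5, 5243 / 40, 2224 / 5, 31131 / 40,
   413, 539 / 40, 5796 / 5, 7547 / 40, 1477 / 5, 5823 / 8, 2488 / 5, 8603 / 40, 4689 / 5, 2651 / 40,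
   524, 31419 / 40, 1741 / 5, 827 / 40, 5832 / 5, 2143 / 8, 1513 / 5, 26523 / 40, 2164 / 5, 8891 / 40,
   1017, 2939 / 40, 2656 / 5, 28827 / 40, 1777 / 5, 799 / 8, 5508 / 5, 11003 / 40, 1189 / 5, 26811 / 40,
   584, 6299 / 40, 5121 / 5, 347 / 40, 2332 / 5, 6975 / 8, 1453 / 5, 4283 / 40, 5544 / 5, 8411 / 40,
   389, 24219 / 40, 2596 / 5, 6587 / 40, 4797 / 5, 1279 / 8, 2368 / 5, 32283 / 40, 1489 / 5, 1691 / 40,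
   1188, 8699 / 40, 1621 / 5, 24507 / 40, 2632 / 5, 1951 / 8, 4833 / 5, 3803 / 40, 2044 / 5, 32571 / 40,
   377, 1979 / 40, 5976 / 5, 6107 / 40, 1657 / 5, 5535 / 8, 2308 / 5, 10043 / 40, 4509 / 5, 4091 / 40,
   560, 29979 / 40, 1921 / 5, -613 / 40, 5652 / 5, 2431 / 8, 1333 / 5, 27963 / 40, 2344 / 5, 7451 / 40,
   1053, 1499 / 40, 2476 / 5, 30267 / 40, 1597 / 5, 1087 / 8, 5688 / 5, 9563 / 40, 1369 / 5, 25371 / 40,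
   548, 7739 / 40, 4941 / 5, 1787 / 40, 2512 / 5, 6687 / 8, 1633 / 5, 2843 / 40, 5364 / 5, 9851 / 40,
   353, 25659 / 40, 2776 / 5, 5147 / 40, 4977 / 5, 991 / 8, 2188 / 5, 33723 / 40, 1309 / 5, 3131 / 40]

/-- The coefficient `a₀(t)`, by the residue of `t` modulo 120. -/
def coeffA0 (t : ℕ) : ℚ := tableA0.getD (t % 120) 0

/-- `S₇(t) = ⌊(t - 1) / 21⌋ + [t ≡ 10, 13, 16, 17, 19, 20 mod 21]`
(integer division by `21` rounds down). -/
def correctionS7 (t : ℕ) : ℤ :=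
  ((t : ℤ) - 1) / 21 + if t % 21 ∈ [10, 13, 16, 17, 19, 20] then 1 else 0

/-!
The count of the squares reduces to counting positive integer points off seven hyperplanes.

A normalized square with smallest entry `m` has the form
```
m            m + f + h   m + f + h + 2p + q
m + f+h+p    m + h+p+q   m + f
m + f+h+p+q  m + f + p   m + h
```
for unique positive integers `f, h, p, q`, and its magic sum is `3m + 2f + 2h + 2p + q`
(`exists_quad_of_isNormalized`). Its entries are distinct exactly when `(f, h, p, q)` avoids the
hyperplanes `f = h`, `f = h + q`, `f = h + p + q`, `f = p + q`, `f = q`, `h = p`, `h = f + p`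
(`OffHyperplanes`). Row permutations, column permutations and transposition normalize a semimagic
square in exactly one of `72` ways (`semimagicCount_eq`), and the smallest entry is one more positive
variable of weight `3`, which gives the factor `x³ / (1 - x³)` (`genFun_semimagicCount_mul`).

Inclusion and exclusion over the hyperplanes (`ind_offHyperplanes`) writes the indicator of the good
quadruples as a signed sum over cells, each of which is the image of free positive integer variables.
A cell with weights `w₁, …, wₖ` has the generating function `∏ x^wᵢ / (1 - x^wᵢ)`; the sum of these is
the rational function of the theorem (`quadGF_offHyperplanes_mul`).

For the explicit formula, multiplication of a power series by `1 - x ^ k` takes differences with step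
`k` of its coefficients. The differences with the steps `3, 3, 4, 5, 6, 7, 8` of the explicit formula
have to be the coefficients of the numerator. They are annihilated, past the degree of the numerator,
by differences with the steps `1, 21, 1, 1, 6, 12, 120`, since the coefficients of the formula are
periodic; so finitely many values decide (`fwdDiffs_paddedCount`).

The constituents can be read off the formula, and constituents for two moduli agree wherever they are
used at a common argument (`AreConstituents.eq`). If `q` constituents were enough, the constituents
modulo `840` of `0` and `q` would be equal; for `0 < q < 840` their coefficients differ
(`constituent_ne_constituent_zero`).
-/

/-! ### Generating functions of weighted families -/

/-- The generating function `∑ v, φ v * x ^ w v` of a family weighted by `w`, with coefficients `φ`.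
It is meaningful when every fibre of `w` is finite. -/
noncomputable def weightGF {ι : Type*} (w : ι → ℕ) (φ : ι → ℚ) : PowerSeries ℚ :=
  PowerSeries.mk fun n => ∑ᶠ v ∈ {v | w v = n}, φ v

/-- Every value of the weight is taken finitely often. -/
def FiniteFibres {ι : Type*} (w : ι → ℕ) : Prop := ∀ n, {v | w v = n}.Finite

section WeightGF

variable {ι κ : Type*} {w : ι → ℕ}

lemma coeff_weightGF (φ : ι → ℚ) (n : ℕ) :
    PowerSeries.coeff n (weightGF w φ) = ∑ᶠ v ∈ {v | w v = n}, φ v := by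
  simp [weightGF]

lemma weightGF_add (hw : FiniteFibres w) (φ ψ : ι → ℚ) :
    weightGF w (fun v => φ v + ψ v) = weightGF w φ + weightGF w ψ := by
  ext n
  rw [map_add, coeff_weightGF, coeff_weightGF, coeff_weightGF, finsum_mem_add_distrib (hw n)]

lemma weightGF_sub (hw : FiniteFibres w) (φ ψ : ι → ℚ) :
    weightGF w (fun v => φ v - ψ v) = weightGF w φ - weightGF w ψ := by
  ext n
  rw [map_sub, coeff_weightGF, coeff_weightGF, coeff_weightGF, finsum_mem_sub_distrib φ ψ (hw n)]

lemma finsum_mem_ite_one (s : Set ι) (P : ι → Prop) [DecidablePred P] :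
    ∑ᶠ v ∈ s, (if P v then (1 : ℚ) else 0) = ((s ∩ {v | P v}).ncard : ℚ) := by
  have h1 : ∑ᶠ v ∈ s, (if P v then (1 : ℚ) else 0) = ∑ᶠ v ∈ s ∩ {v | P v}, (1 : ℚ) := by
    refine finsum_congr fun v => ?_
    by_cases hs : v ∈ s <;> by_cases hP : P v <;> simp [hs, hP]
  by_cases hf : (s ∩ {v | P v}).Finite
  · rw [h1, finsum_mem_eq_finite_toFinset_sum _ hf, Set.ncard_eq_toFinset_card _ hf]
    simp
  · rw [h1, Set.Infinite.ncard hf, Nat.cast_zero]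
    apply finsum_mem_eq_zero_of_infinite
    rwa [Function.support_const one_ne_zero, Set.inter_univ]

lemma coeff_weightGF_ite (P : ι → Prop) [DecidablePred P] (n : ℕ) :
    PowerSeries.coeff n (weightGF w fun v => if P v then 1 else 0)
      = ({v | w v = n ∧ P v}.ncard : ℚ) := by
  rw [coeff_weightGF, finsum_mem_ite_one]
  rfl

/-- The generating function of a subfamily that is parametrized by `g`, with inverse `g'`. -/
lemma weightGF_ite_eq {w' : κ → ℕ} (P : ι → Prop) [DecidablePred P] (g : κ → ι) (g' : ι → κ)
    (hP : ∀ u, P (g u)) (hl : ∀ u, g' (g u) = u) (hr : ∀ v, P v → g (g' v) = v)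
    (hw : ∀ u, w (g u) = w' u) :
    weightGF w (fun v => if P v then 1 else 0) = weightGF w' fun _ => 1 := by
  ext n
  have h := coeff_weightGF_ite (w := w') (fun _ => True) n
  simp only [if_true, and_true] at h
  rw [coeff_weightGF_ite, h, ← Set.ncard_image_of_injective _ (Function.LeftInverse.injective hl)]
  congr 2
  ext v
  simp only [Set.mem_ofPred_eq, Set.mem_image]
  constructor
  · rintro ⟨h1, h2⟩
    exact ⟨g' v, by rw [← hw, hr v h2, h1], hr v h2⟩
  · rintro ⟨u, h1, rfl⟩
    exact ⟨by rw [hw, h1], hP u⟩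

/-- Adjoin to a weighted family one positive integer variable `n + 1` of weight `k`. -/
def adjoinWeight (k : ℕ) (w : ι → ℕ) : ℕ × ι → ℕ := fun v => k * (v.1 + 1) + w v.2

lemma FiniteFibres.adjoin (hw : FiniteFibres w) {k : ℕ} (hk : 0 < k) :
    FiniteFibres (adjoinWeight k w) := by
  intro n
  have h : ((Set.Iic n) ×ˢ ⋃ m ∈ Set.Iic n, {v | w v = m}).Finite :=
    (Set.finite_Iic n).prod ((Set.finite_Iic n).biUnion fun m _ => hw m)
  refine h.subset ?_
  rintro ⟨a, v⟩ hv
  simp only [adjoinWeight, Set.mem_ofPred_eq] at hv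
  simp only [Set.mem_prod, Set.mem_Iic, Set.mem_iUnion, Set.mem_ofPred_eq, exists_prop,
    exists_eq_right']
  have : a + 1 ≤ k * (a + 1) := Nat.le_mul_of_pos_left _ hk
  omega

/-- A positive integer variable of weight `k` contributes the factor `x ^ k / (1 - x ^ k)`:
such a variable is either `1` or one more than another one. -/
lemma weightGF_adjoin (hw : FiniteFibres w) {k : ℕ} (hk : 0 < k) (φ : ι → ℚ) :
    weightGF (adjoinWeight k w) (fun v => φ v.2) * (1 - PowerSeries.X ^ k)
      = PowerSeries.X ^ k * weightGF w φ := by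
  have hw' := hw.adjoin hk
  have key : weightGF (adjoinWeight k w) (fun v => φ v.2)
      = PowerSeries.X ^ k * weightGF w φ
        + PowerSeries.X ^ k * weightGF (adjoinWeight k w) (fun v => φ v.2) := by
    ext n
    rw [map_add, PowerSeries.coeff_X_pow_mul', PowerSeries.coeff_X_pow_mul']
    split_ifs with hn
    · rw [coeff_weightGF, coeff_weightGF, coeff_weightGF]
      have hsplit : {v | adjoinWeight k w v = n}
          = ((fun v => ((0 : ℕ), v)) '' {v | w v = n - k})
            ∪ ((fun v : ℕ × ι => (v.1 + 1, v.2)) '' {v | adjoinWeight k w v = n - k}) := by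
        ext ⟨a, v⟩
        simp only [adjoinWeight, Set.mem_ofPred_eq, Set.mem_union, Set.mem_image, Prod.mk.injEq,
          Prod.exists]
        constructor
        · intro h
          rcases a with _ | a
          · exact Or.inl ⟨v, by simp at h; omega, rfl, rfl⟩
          · refine Or.inr ⟨a, v, ?_, rfl, rfl⟩
            rw [mul_add k (a + 1), mul_one] at h
            omega
        · rintro (⟨v', h, rfl, rfl⟩ | ⟨a', v', h, rfl, rfl⟩)
          · simp; omega
          · rw [mul_add k (a' + 1), mul_one]
            omega
      rw [hsplit, finsum_mem_union _ ((hw _).image _) ((hw' _).image _), finsum_mem_image,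
        finsum_mem_image]
      · rintro ⟨a, v⟩ _ ⟨b, u⟩ _ h
        simpa using h
      · intro v _ u _ h
        simpa using h
      · rw [Set.disjoint_left]
        rintro _ ⟨v, _, rfl⟩ ⟨u, _, h⟩
        simp at h
    · rw [coeff_weightGF, add_zero]
      have hempty : {v | adjoinWeight k w v = n} = ∅ := by
        ext ⟨a, v⟩
        simp only [adjoinWeight, Set.mem_ofPred_eq, Set.mem_empty_iff_false, iff_false]
        have : k * 1 ≤ k * (a + 1) := Nat.mul_le_mul_left _ (by omega)
        omega
      rw [hempty, finsum_mem_empty]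
  linear_combination key

end WeightGF

/-- The weight of the one-point family, which is the start of every free family of positive integer
variables. -/
def pointWeight : Unit → ℕ := fun _ => 0

lemma finiteFibres_pointWeight : FiniteFibres pointWeight := fun _ => Set.toFinite _

lemma weightGF_pointWeight : weightGF pointWeight (fun _ => 1) = 1 := by
  ext n
  rw [coeff_weightGF, PowerSeries.coeff_one]
  split_ifs with h
  · subst h
    simp [pointWeight, finsum_unique]
  · have : {v | pointWeight v = n} = ∅ := by
      ext v
      simpa [pointWeight] using fun h' => h h'.symm
    rw [this, finsum_mem_empty]

/-- The generating function of two free positive integer variables of weights `a`, `b`. -/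
noncomputable def freeGF₂ (a b : ℕ) : PowerSeries ℚ :=
  weightGF (adjoinWeight a (adjoinWeight b pointWeight)) fun _ => 1

/-- The generating function of three free positive integer variables of weights `a`, `b`, `c`. -/
noncomputable def freeGF₃ (a b c : ℕ) : PowerSeries ℚ :=
  weightGF (adjoinWeight a (adjoinWeight b (adjoinWeight c pointWeight))) fun _ => 1

/-- The generating function of four free positive integer variables of weights `a`, `b`, `c`,
`d`. -/
noncomputable def freeGF₄ (a b c d : ℕ) : PowerSeries ℚ :=
  weightGF (adjoinWeight a (adjoinWeight b (adjoinWeight c (adjoinWeight d pointWeight))))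
    fun _ => 1

lemma freeGF₂_mul {a b : ℕ} (ha : 0 < a) (hb : 0 < b) :
    freeGF₂ a b * ((1 - PowerSeries.X ^ a) * (1 - PowerSeries.X ^ b))
      = PowerSeries.X ^ (a + b) := by
  have h0 := finiteFibres_pointWeight
  have h1 := weightGF_adjoin h0 hb (fun _ => 1)
  have h2 := weightGF_adjoin (h0.adjoin hb) ha (fun _ => 1)
  rw [weightGF_pointWeight] at h1
  rw [freeGF₂, pow_add]
  linear_combination (1 - PowerSeries.X ^ b) * h2 + PowerSeries.X ^ a * h1

lemma freeGF₃_mul {a b c : ℕ} (ha : 0 < a) (hb : 0 < b) (hc : 0 < c) :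
    freeGF₃ a b c * ((1 - PowerSeries.X ^ a) * (1 - PowerSeries.X ^ b) * (1 - PowerSeries.X ^ c))
      = PowerSeries.X ^ (a + b + c) := by
  have h1 := freeGF₂_mul hb hc
  have h2 := weightGF_adjoin ((finiteFibres_pointWeight.adjoin hc).adjoin hb) ha (fun _ => 1)
  rw [freeGF₂] at h1
  rw [freeGF₃, add_assoc, pow_add]
  linear_combination (1 - PowerSeries.X ^ b) * (1 - PowerSeries.X ^ c) * h2
    + PowerSeries.X ^ a * h1

lemma freeGF₄_mul {a b c d : ℕ} (ha : 0 < a) (hb : 0 < b) (hc : 0 < c) (hd : 0 < d) :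
    freeGF₄ a b c d * ((1 - PowerSeries.X ^ a) * (1 - PowerSeries.X ^ b) * (1 - PowerSeries.X ^ c)
          * (1 - PowerSeries.X ^ d))
      = PowerSeries.X ^ (a + b + c + d) := by
  have h1 := freeGF₃_mul hb hc hd
  have h2 := weightGF_adjoin (((finiteFibres_pointWeight.adjoin hd).adjoin hc).adjoin hb) ha
    (fun _ => 1)
  have h3 : a + b + c + d = a + (b + c + d) := by ring
  rw [freeGF₃] at h1
  rw [freeGF₄, h3, pow_add]
  linear_combination (1 - PowerSeries.X ^ b) * (1 - PowerSeries.X ^ c) * (1 - PowerSeries.X ^ d) * h2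
    + PowerSeries.X ^ a * h1

/-! ### Quadruples off seven hyperplanes -/

/-- Quadruples `(f, h, p, q)` of positive integers, stored as `(f - 1, h - 1, p - 1, q - 1)`; the
unit at the end is the base of `adjoinWeight`. -/
abbrev Quad : Type := ℕ × ℕ × ℕ × ℕ × Unit

/-- The weight `2 f + 2 h + 2 p + q` of a quadruple. -/
def quadWeight : Quad → ℕ :=
  adjoinWeight 2 (adjoinWeight 2 (adjoinWeight 2 (adjoinWeight 1 pointWeight)))

lemma finiteFibres_quadWeight : FiniteFibres quadWeight :=
  (((finiteFibres_pointWeight.adjoin one_pos).adjoin two_pos).adjoin two_pos).adjoin two_pos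

lemma adjoin₂_apply (a b : ℕ) (u : ℕ × ℕ × Unit) :
    adjoinWeight a (adjoinWeight b pointWeight) u = a * (u.1 + 1) + b * (u.2.1 + 1) := rfl

lemma adjoin₃_apply (a b c : ℕ) (u : ℕ × ℕ × ℕ × Unit) :
    adjoinWeight a (adjoinWeight b (adjoinWeight c pointWeight)) u
      = a * (u.1 + 1) + (b * (u.2.1 + 1) + c * (u.2.2.1 + 1)) := rfl

lemma adjoin₄_apply (a b c d : ℕ) (u : Quad) :
    adjoinWeight a (adjoinWeight b (adjoinWeight c (adjoinWeight d pointWeight))) u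
      = a * (u.1 + 1) + (b * (u.2.1 + 1) + (c * (u.2.2.1 + 1) + d * (u.2.2.2.1 + 1))) := rfl

lemma quadWeight_apply (v : Quad) : quadWeight v
    = 2 * (v.1 + 1) + 2 * (v.2.1 + 1) + 2 * (v.2.2.1 + 1) + (v.2.2.2.1 + 1) := by
  rw [quadWeight, adjoin₄_apply]
  omega

/-- The quadruple has a given property, stated in terms of `f, h, p, q`. -/
def Quad.Sat (C : ℕ → ℕ → ℕ → ℕ → Prop) (v : Quad) : Prop :=
  C (v.1 + 1) (v.2.1 + 1) (v.2.2.1 + 1) (v.2.2.2.1 + 1)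

open Classical in
/-- The indicator function of the quadruples with a given property. -/
noncomputable def Quad.ind (C : ℕ → ℕ → ℕ → ℕ → Prop) (v : Quad) : ℚ := if v.Sat C then 1 else 0

/-- The generating function of the quadruples with a given property. -/
noncomputable def quadGF (C : ℕ → ℕ → ℕ → ℕ → Prop) : PowerSeries ℚ :=
  weightGF quadWeight (Quad.ind C)

/-- The quadruple `(f, h, p, q)` is off the seven hyperplanes on which two entries of its square
coincide. -/
def OffHyperplanes (f h p q : ℕ) : Prop :=
  f ≠ h ∧ f ≠ h + q ∧ f ≠ h + p + q ∧ f ≠ p + q ∧ f ≠ q ∧ h ≠ p ∧ h ≠ f + p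

/-- A cell that is parametrized by a free family has the generating function of that family. -/
lemma quadGF_eq_of_param {κ : Type*} {w' : κ → ℕ} (C : ℕ → ℕ → ℕ → ℕ → Prop) (g : κ → Quad)
    (g' : Quad → κ) (hP : ∀ u, (g u).Sat C) (hl : ∀ u, g' (g u) = u)
    (hr : ∀ v : Quad, v.Sat C → g (g' v) = v) (hw : ∀ u, quadWeight (g u) = w' u) :
    quadGF C = weightGF w' fun _ => 1 := by
  classical
  rw [← weightGF_ite_eq (w := quadWeight) (Quad.Sat C) g g' hP hl hr hw, quadGF]
  congr 1

/-- Inclusion and exclusion over the seven hyperplanes, for an indicator `C` of propositions. In the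
chamber `f < h` only `f = q`, `f = p + q`, `h = p`, `h = f + p` can occur; the first two exclude each
other, and so do the last two. In the chamber `h < f` only `f = h + q`, `f = h + p + q`, `f = p + q`,
`f = q`, `h = p` can occur; among the first four only `f = h + q` and `f = p + q` meet, and they do so
on `h = p`. The cell of `f = p + q` is cut along `h = p`, so that every cell is parametrized by free
positive integers. -/
lemma ind_offHyperplanes (f h p q : ℕ) (hf : 0 < f) (hh : 0 < h) (hp : 0 < p) (hq : 0 < q)
    (C : Prop → ℚ) (hC : ∀ P, P → C P = 1) (hC' : ∀ P, ¬ P → C P = 0) :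
    C (OffHyperplanes f h p q) =
      (C (f < h) - C (f < h ∧ q = f) - C (f < h ∧ f = p + q) - C (f < h ∧ p = h)
        - C (f < h ∧ f + p = h) + C (f < h ∧ q = f ∧ p = h) + C (f < h ∧ q = f ∧ f + p = h)
        + C (f < h ∧ f = p + q ∧ f + p = h))
      + (C (h < f) - C (h < f ∧ f = h + q) - C (f = h + p + q) - C (f = p + q ∧ h < p)
        - C (f = p + q ∧ p < h ∧ h < f) - C (h < f ∧ f = q) - C (h < f ∧ h = p)
        + C (f = h + q ∧ h = p) + C (f = h + p + q ∧ h = p) + C (h < f ∧ f = q ∧ h = p)) := by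
  rcases lt_trichotomy f h with h1 | h1 | h1
  · by_cases h2 : q = f <;> by_cases h3 : f = p + q <;> by_cases h4 : p = h <;>
      by_cases h5 : f + p = h <;> first
      | omega
      | simp (disch := omega) only [hC, hC', OffHyperplanes]; norm_num
  · simp (disch := omega) only [hC', OffHyperplanes]
    norm_num
  · by_cases h2 : f = h + q <;> by_cases h3 : f = h + p + q <;> by_cases h4 : f = p + q <;>
      by_cases h5 : f = q <;> rcases lt_trichotomy h p with h6 | h6 | h6 <;> first
      | omega
      | simp (disch := omega) only [hC, hC', OffHyperplanes]; norm_num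

set_option linter.unusedVariables false in
lemma quadGF_offHyperplanes :
    quadGF OffHyperplanes =
      (quadGF (fun f h p q => f < h) - quadGF (fun f h p q => f < h ∧ q = f)
        - quadGF (fun f h p q => f < h ∧ f = p + q) - quadGF (fun f h p q => f < h ∧ p = h)
        - quadGF (fun f h p q => f < h ∧ f + p = h)
        + quadGF (fun f h p q => f < h ∧ q = f ∧ p = h)
        + quadGF (fun f h p q => f < h ∧ q = f ∧ f + p = h)
        + quadGF (fun f h p q => f < h ∧ f = p + q ∧ f + p = h))
      + (quadGF (fun f h p q => h < f) - quadGF (fun f h p q => h < f ∧ f = h + q)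
        - quadGF (fun f h p q => f = h + p + q) - quadGF (fun f h p q => f = p + q ∧ h < p)
        - quadGF (fun f h p q => f = p + q ∧ p < h ∧ h < f)
        - quadGF (fun f h p q => h < f ∧ f = q) - quadGF (fun f h p q => h < f ∧ h = p)
        + quadGF (fun f h p q => f = h + q ∧ h = p)
        + quadGF (fun f h p q => f = h + p + q ∧ h = p)
        + quadGF (fun f h p q => h < f ∧ f = q ∧ h = p)) := by
  classical
  simp only [quadGF, ← weightGF_add finiteFibres_quadWeight,
    ← weightGF_sub finiteFibres_quadWeight]
  congr 1
  funext v
  exact ind_offHyperplanes (v.1 + 1) (v.2.1 + 1) (v.2.2.1 + 1) (v.2.2.2.1 + 1) (by omega)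
    (by omega) (by omega) (by omega) (fun P => if P then 1 else 0) (fun P hP => if_pos hP)
    (fun P hP => if_neg hP)

/-! ### Free parametrizations of the cells -/

lemma quadGF_lt :
    quadGF (fun f h _ _ => f < h) = freeGF₄ 4 2 2 1 :=
  quadGF_eq_of_param _ (fun u => (u.1, u.1 + u.2.1 + 1, u.2.2.1, u.2.2.2.1, ()))
    (fun v => (v.1, v.2.1 - v.1 - 1, v.2.2.1, v.2.2.2.1, ()))
    (fun u => by dsimp only [Quad.Sat]; omega)
    (fun u => by ext <;> dsimp only <;> omega)
    (fun v hv => by simp only [Quad.Sat] at hv; ext <;> dsimp only <;> omega)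
    (fun u => by rw [quadWeight_apply, adjoin₄_apply]; dsimp only; omega)

lemma quadGF_lt_q_eq_f :
    quadGF (fun f h _ q => f < h ∧ q = f) = freeGF₃ 5 2 2 :=
  quadGF_eq_of_param _ (fun u => (u.1, u.1 + u.2.1 + 1, u.2.2.1, u.1, ()))
    (fun v => (v.1, v.2.1 - v.1 - 1, v.2.2.1, ()))
    (fun u => by dsimp only [Quad.Sat]; omega)
    (fun u => by ext <;> dsimp only <;> omega)
    (fun v hv => by simp only [Quad.Sat] at hv; ext <;> dsimp only <;> omega)
    (fun u => by rw [quadWeight_apply, adjoin₃_apply]; dsimp only; omega)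

lemma quadGF_lt_f_eq_p_add_q :
    quadGF (fun f h p q => f < h ∧ f = p + q) = freeGF₃ 6 5 2 :=
  quadGF_eq_of_param _ (fun u => (u.1 + u.2.1 + 1, u.1 + u.2.1 + u.2.2.1 + 2, u.1, u.2.1, ()))
    (fun v => (v.2.2.1, v.2.2.2.1, v.2.1 - v.1 - 1, ()))
    (fun u => by dsimp only [Quad.Sat]; omega)
    (fun u => by ext <;> dsimp only <;> omega)
    (fun v hv => by simp only [Quad.Sat] at hv; ext <;> dsimp only <;> omega)
    (fun u => by rw [quadWeight_apply, adjoin₃_apply]; dsimp only; omega)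

lemma quadGF_lt_p_eq_h :
    quadGF (fun f h p _ => f < h ∧ p = h) = freeGF₃ 6 4 1 :=
  quadGF_eq_of_param _ (fun u => (u.1, u.1 + u.2.1 + 1, u.1 + u.2.1 + 1, u.2.2.1, ()))
    (fun v => (v.1, v.2.1 - v.1 - 1, v.2.2.2.1, ()))
    (fun u => by dsimp only [Quad.Sat]; omega)
    (fun u => by ext <;> dsimp only <;> omega)
    (fun v hv => by simp only [Quad.Sat] at hv; ext <;> dsimp only <;> omega)
    (fun u => by rw [quadWeight_apply, adjoin₃_apply]; dsimp only; omega)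

lemma quadGF_lt_f_add_p_eq_h :
    quadGF (fun f h p _ => f < h ∧ f + p = h) = freeGF₃ 4 4 1 :=
  quadGF_eq_of_param _ (fun u => (u.1, u.1 + u.2.1 + 1, u.2.1, u.2.2.1, ()))
    (fun v => (v.1, v.2.2.1, v.2.2.2.1, ()))
    (fun u => by dsimp only [Quad.Sat]; omega)
    (fun u => by ext <;> dsimp only <;> omega)
    (fun v hv => by simp only [Quad.Sat] at hv; ext <;> dsimp only <;> omega)
    (fun u => by rw [quadWeight_apply, adjoin₃_apply]; dsimp only; omega)

lemma quadGF_lt_q_eq_f_p_eq_h :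
    quadGF (fun f h p q => f < h ∧ q = f ∧ p = h) = freeGF₂ 7 4 :=
  quadGF_eq_of_param _ (fun u => (u.1, u.1 + u.2.1 + 1, u.1 + u.2.1 + 1, u.1, ()))
    (fun v => (v.1, v.2.1 - v.1 - 1, ()))
    (fun u => by dsimp only [Quad.Sat]; omega)
    (fun u => by ext <;> dsimp only <;> omega)
    (fun v hv => by simp only [Quad.Sat] at hv; ext <;> dsimp only <;> omega)
    (fun u => by rw [quadWeight_apply, adjoin₂_apply]; dsimp only; omega)

lemma quadGF_lt_q_eq_f_f_add_p_eq_h :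
    quadGF (fun f h p q => f < h ∧ q = f ∧ f + p = h) = freeGF₂ 5 4 :=
  quadGF_eq_of_param _ (fun u => (u.1, u.1 + u.2.1 + 1, u.2.1, u.1, ()))
    (fun v => (v.1, v.2.2.1, ()))
    (fun u => by dsimp only [Quad.Sat]; omega)
    (fun u => by ext <;> dsimp only <;> omega)
    (fun v hv => by simp only [Quad.Sat] at hv; ext <;> dsimp only <;> omega)
    (fun u => by rw [quadWeight_apply, adjoin₂_apply]; dsimp only; omega)

lemma quadGF_lt_f_eq_p_add_q_f_add_p_eq_h :
    quadGF (fun f h p q => f < h ∧ f = p + q ∧ f + p = h) = freeGF₂ 8 5 :=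
  quadGF_eq_of_param _ (fun u => (u.1 + u.2.1 + 1, 2 * u.1 + u.2.1 + 2, u.1, u.2.1, ()))
    (fun v => (v.2.2.1, v.2.2.2.1, ()))
    (fun u => by dsimp only [Quad.Sat]; omega)
    (fun u => by ext <;> dsimp only <;> omega)
    (fun v hv => by simp only [Quad.Sat] at hv; ext <;> dsimp only <;> omega)
    (fun u => by rw [quadWeight_apply, adjoin₂_apply]; dsimp only; omega)

lemma quadGF_gt :
    quadGF (fun f h _ _ => h < f) = freeGF₄ 4 2 2 1 :=
  quadGF_eq_of_param _ (fun u => (u.1 + u.2.1 + 1, u.1, u.2.2.1, u.2.2.2.1, ()))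
    (fun v => (v.2.1, v.1 - v.2.1 - 1, v.2.2.1, v.2.2.2.1, ()))
    (fun u => by dsimp only [Quad.Sat]; omega)
    (fun u => by ext <;> dsimp only <;> omega)
    (fun v hv => by simp only [Quad.Sat] at hv; ext <;> dsimp only <;> omega)
    (fun u => by rw [quadWeight_apply, adjoin₄_apply]; dsimp only; omega)

lemma quadGF_gt_f_eq_h_add_q :
    quadGF (fun f h _ q => h < f ∧ f = h + q) = freeGF₃ 4 3 2 :=
  quadGF_eq_of_param _ (fun u => (u.1 + u.2.1 + 1, u.1, u.2.2.1, u.2.1, ()))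
    (fun v => (v.2.1, v.2.2.2.1, v.2.2.1, ()))
    (fun u => by dsimp only [Quad.Sat]; omega)
    (fun u => by ext <;> dsimp only <;> omega)
    (fun v hv => by simp only [Quad.Sat] at hv; ext <;> dsimp only <;> omega)
    (fun u => by rw [quadWeight_apply, adjoin₃_apply]; dsimp only; omega)

lemma quadGF_gt_f_eq_h_add_p_add_q :
    quadGF (fun f h p q => f = h + p + q) = freeGF₃ 4 4 3 :=
  quadGF_eq_of_param _ (fun u => (u.1 + u.2.1 + u.2.2.1 + 2, u.1, u.2.1, u.2.2.1, ()))
    (fun v => (v.2.1, v.2.2.1, v.2.2.2.1, ()))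
    (fun u => by dsimp only [Quad.Sat]; omega)
    (fun u => by ext <;> dsimp only <;> omega)
    (fun v hv => by simp only [Quad.Sat] at hv; ext <;> dsimp only <;> omega)
    (fun u => by rw [quadWeight_apply, adjoin₃_apply]; dsimp only; omega)

lemma quadGF_gt_f_eq_p_add_q_h_lt_p :
    quadGF (fun f h p q => f = p + q ∧ h < p) = freeGF₃ 6 4 3 :=
  quadGF_eq_of_param _ (fun u => (u.1 + u.2.1 + u.2.2.1 + 2, u.1, u.1 + u.2.1 + 1, u.2.2.1, ()))
    (fun v => (v.2.1, v.2.2.1 - v.2.1 - 1, v.2.2.2.1, ()))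
    (fun u => by dsimp only [Quad.Sat]; omega)
    (fun u => by ext <;> dsimp only <;> omega)
    (fun v hv => by simp only [Quad.Sat] at hv; ext <;> dsimp only <;> omega)
    (fun u => by rw [quadWeight_apply, adjoin₃_apply]; dsimp only; omega)

lemma quadGF_gt_f_eq_p_add_q_p_lt_h :
    quadGF (fun f h p q => f = p + q ∧ p < h ∧ h < f) = freeGF₃ 6 5 3 :=
  quadGF_eq_of_param _ (fun u => (u.1 + u.2.1 + u.2.2.1 + 2, u.1 + u.2.1 + 1, u.1, u.2.1 + u.2.2.1 + 1, ()))
    (fun v => (v.2.2.1, v.2.1 - v.2.2.1 - 1, v.1 - v.2.1 - 1, ()))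
    (fun u => by dsimp only [Quad.Sat]; omega)
    (fun u => by ext <;> dsimp only <;> omega)
    (fun v hv => by simp only [Quad.Sat] at hv; ext <;> dsimp only <;> omega)
    (fun u => by rw [quadWeight_apply, adjoin₃_apply]; dsimp only; omega)

lemma quadGF_gt_f_eq_q :
    quadGF (fun f h _ q => h < f ∧ f = q) = freeGF₃ 5 3 2 :=
  quadGF_eq_of_param _ (fun u => (u.1 + u.2.1 + 1, u.1, u.2.2.1, u.1 + u.2.1 + 1, ()))
    (fun v => (v.2.1, v.1 - v.2.1 - 1, v.2.2.1, ()))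
    (fun u => by dsimp only [Quad.Sat]; omega)
    (fun u => by ext <;> dsimp only <;> omega)
    (fun v hv => by simp only [Quad.Sat] at hv; ext <;> dsimp only <;> omega)
    (fun u => by rw [quadWeight_apply, adjoin₃_apply]; dsimp only; omega)

lemma quadGF_gt_h_eq_p :
    quadGF (fun f h p _ => h < f ∧ h = p) = freeGF₃ 6 2 1 :=
  quadGF_eq_of_param _ (fun u => (u.1 + u.2.1 + 1, u.1, u.1, u.2.2.1, ()))
    (fun v => (v.2.1, v.1 - v.2.1 - 1, v.2.2.2.1, ()))
    (fun u => by dsimp only [Quad.Sat]; omega)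
    (fun u => by ext <;> dsimp only <;> omega)
    (fun v hv => by simp only [Quad.Sat] at hv; ext <;> dsimp only <;> omega)
    (fun u => by rw [quadWeight_apply, adjoin₃_apply]; dsimp only; omega)

lemma quadGF_gt_f_eq_h_add_q_h_eq_p :
    quadGF (fun f h p q => f = h + q ∧ h = p) = freeGF₂ 6 3 :=
  quadGF_eq_of_param _ (fun u => (u.1 + u.2.1 + 1, u.1, u.1, u.2.1, ()))
    (fun v => (v.2.1, v.2.2.2.1, ()))
    (fun u => by dsimp only [Quad.Sat]; omega)
    (fun u => by ext <;> dsimp only <;> omega)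
    (fun v hv => by simp only [Quad.Sat] at hv; ext <;> dsimp only <;> omega)
    (fun u => by rw [quadWeight_apply, adjoin₂_apply]; dsimp only; omega)

lemma quadGF_gt_f_eq_h_add_p_add_q_h_eq_p :
    quadGF (fun f h p q => f = h + p + q ∧ h = p) = freeGF₂ 8 3 :=
  quadGF_eq_of_param _ (fun u => (2 * u.1 + u.2.1 + 2, u.1, u.1, u.2.1, ()))
    (fun v => (v.2.1, v.2.2.2.1, ()))
    (fun u => by dsimp only [Quad.Sat]; omega)
    (fun u => by ext <;> dsimp only <;> omega)
    (fun v hv => by simp only [Quad.Sat] at hv; ext <;> dsimp only <;> omega)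
    (fun u => by rw [quadWeight_apply, adjoin₂_apply]; dsimp only; omega)

lemma quadGF_gt_f_eq_q_h_eq_p :
    quadGF (fun f h p q => h < f ∧ f = q ∧ h = p) = freeGF₂ 7 3 :=
  quadGF_eq_of_param _ (fun u => (u.1 + u.2.1 + 1, u.1, u.1, u.1 + u.2.1 + 1, ()))
    (fun v => (v.2.1, v.1 - v.2.1 - 1, ()))
    (fun u => by dsimp only [Quad.Sat]; omega)
    (fun u => by ext <;> dsimp only <;> omega)
    (fun v hv => by simp only [Quad.Sat] at hv; ext <;> dsimp only <;> omega)
    (fun u => by rw [quadWeight_apply, adjoin₂_apply]; dsimp only; omega)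

/-! ### The generating function of the quadruples as a rational function -/

theorem quadGF_offHyperplanes_mul :
    quadGF OffHyperplanes * ((1 - PowerSeries.X ^ 3) * (1 - PowerSeries.X ^ 4)
        * (1 - PowerSeries.X ^ 5) * (1 - PowerSeries.X ^ 6) * (1 - PowerSeries.X ^ 7)
        * (1 - PowerSeries.X ^ 8))
      = PowerSeries.X ^ 12 *
        (18 * PowerSeries.X ^ 21 + 5 * PowerSeries.X ^ 20 + 15 * PowerSeries.X ^ 19
          + 11 * PowerSeries.X ^ 17 - 8 * PowerSeries.X ^ 16 + PowerSeries.X ^ 15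
          - 23 * PowerSeries.X ^ 14 - 13 * PowerSeries.X ^ 13 - 22 * PowerSeries.X ^ 12
          - 9 * PowerSeries.X ^ 11 - 16 * PowerSeries.X ^ 10 + PowerSeries.X ^ 9
          - 3 * PowerSeries.X ^ 8 + 7 * PowerSeries.X ^ 7 + 7 * PowerSeries.X ^ 6
          + 9 * PowerSeries.X ^ 5 + 7 * PowerSeries.X ^ 4 + 6 * PowerSeries.X ^ 3
          + 4 * PowerSeries.X ^ 2 + 2 * PowerSeries.X + 1) := by
  rw [quadGF_offHyperplanes, quadGF_lt, quadGF_lt_q_eq_f, quadGF_lt_f_eq_p_add_q, quadGF_lt_p_eq_h,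
    quadGF_lt_f_add_p_eq_h, quadGF_lt_q_eq_f_p_eq_h, quadGF_lt_q_eq_f_f_add_p_eq_h,
    quadGF_lt_f_eq_p_add_q_f_add_p_eq_h, quadGF_gt, quadGF_gt_f_eq_h_add_q,
    quadGF_gt_f_eq_h_add_p_add_q, quadGF_gt_f_eq_p_add_q_h_lt_p, quadGF_gt_f_eq_p_add_q_p_lt_h,
    quadGF_gt_f_eq_q, quadGF_gt_h_eq_p, quadGF_gt_f_eq_h_add_q_h_eq_p,
    quadGF_gt_f_eq_h_add_p_add_q_h_eq_p, quadGF_gt_f_eq_q_h_eq_p]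
  have h1 : freeGF₄ 4 2 2 1 * _ = _ :=
    freeGF₄_mul four_pos two_pos two_pos one_pos
  have h2 : freeGF₃ 5 2 2 * _ = _ := freeGF₃_mul (by omega) (by omega) (by omega)
  have h3 : freeGF₃ 6 5 2 * _ = _ := freeGF₃_mul (by omega) (by omega) (by omega)
  have h4 : freeGF₃ 6 4 1 * _ = _ := freeGF₃_mul (by omega) (by omega) (by omega)
  have h5 : freeGF₃ 4 4 1 * _ = _ := freeGF₃_mul (by omega) (by omega) (by omega)
  have h6 : freeGF₂ 7 4 * _ = _ := freeGF₂_mul (by omega) (by omega)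
  have h7 : freeGF₂ 5 4 * _ = _ := freeGF₂_mul (by omega) (by omega)
  have h8 : freeGF₂ 8 5 * _ = _ := freeGF₂_mul (by omega) (by omega)
  have h9 : freeGF₃ 4 3 2 * _ = _ := freeGF₃_mul (by omega) (by omega) (by omega)
  have h10 : freeGF₃ 4 4 3 * _ = _ := freeGF₃_mul (by omega) (by omega) (by omega)
  have h11 : freeGF₃ 6 4 3 * _ = _ := freeGF₃_mul (by omega) (by omega) (by omega)
  have h12 : freeGF₃ 6 5 3 * _ = _ := freeGF₃_mul (by omega) (by omega) (by omega)
  have h13 : freeGF₃ 5 3 2 * _ = _ := freeGF₃_mul (by omega) (by omega) (by omega)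
  have h14 : freeGF₃ 6 2 1 * _ = _ := freeGF₃_mul (by omega) (by omega) (by omega)
  have h15 : freeGF₂ 6 3 * _ = _ := freeGF₂_mul (by omega) (by omega)
  have h16 : freeGF₂ 8 3 * _ = _ := freeGF₂_mul (by omega) (by omega)
  have h17 : freeGF₂ 7 3 * _ = _ := freeGF₂_mul (by omega) (by omega)
  have hne : ∀ k : ℕ, 0 < k → (1 - PowerSeries.X ^ k : PowerSeries ℚ) ≠ 0 := by
    intro k hk h
    simpa [hk.ne'] using congrArg PowerSeries.constantCoeff h
  generalize (PowerSeries.X : PowerSeries ℚ) = x at *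
  have hE : (1 - x ^ 1) * (1 - x ^ 2) ^ 2 * (1 - x ^ 4) ≠ 0 :=
    mul_ne_zero (mul_ne_zero (hne 1 (by omega)) (pow_ne_zero 2 (hne 2 (by omega))))
      (hne 4 (by omega))
  refine mul_left_cancel₀ hE ?_
  -- The common denominator is `(1 - x) (1 - x²)² (1 - x³) (1 - x⁴)² (1 - x⁵) ⋯ (1 - x⁸)`; each of
  -- the free generating functions is multiplied by the cofactor of its own denominator.
  set a := 1 - x ^ 1 with ha
  set b := 1 - x ^ 2 with hb
  set c := 1 - x ^ 3 with hc
  set d := 1 - x ^ 4 with hd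
  set e := 1 - x ^ 5 with he
  set f := 1 - x ^ 6 with hf
  set g := 1 - x ^ 7 with hg
  set h := 1 - x ^ 8 with hh
  have key : a * b ^ 2 * d * ((2 * freeGF₄ 4 2 2 1 - freeGF₃ 5 2 2 - freeGF₃ 6 5 2 - freeGF₃ 6 4 1
      - freeGF₃ 4 4 1 + freeGF₂ 7 4 + freeGF₂ 5 4 + freeGF₂ 8 5 - freeGF₃ 4 3 2 - freeGF₃ 4 4 3
      - freeGF₃ 6 4 3 - freeGF₃ 6 5 3 - freeGF₃ 5 3 2 - freeGF₃ 6 2 1 + freeGF₂ 6 3 + freeGF₂ 8 3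
      + freeGF₂ 7 3) * (c * d * e * f * g * h))
      = 2 * x ^ 9 * (c * d * e * f * g * h) - x ^ 9 * (a * c * d ^ 2 * f * g * h)
        - x ^ 13 * (a * b * c * d ^ 2 * g * h) - x ^ 11 * (b ^ 2 * c * d * e * g * h)
        - x ^ 9 * (b ^ 2 * c * e * f * g * h) + x ^ 11 * (a * b ^ 2 * c * d * e * f * h)
        + x ^ 9 * (a * b ^ 2 * c * d * f * g * h) + x ^ 13 * (a * b ^ 2 * c * d ^ 2 * f * g)
        - x ^ 9 * (a * b * d * e * f * g * h) - x ^ 11 * (a * b ^ 2 * e * f * g * h)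
        - x ^ 13 * (a * b ^ 2 * d * e * g * h) - x ^ 14 * (a * b ^ 2 * d ^ 2 * g * h)
        - x ^ 10 * (a * b * d ^ 2 * f * g * h) - x ^ 9 * (b * c * d ^ 2 * e * g * h)
        + x ^ 9 * (a * b ^ 2 * d ^ 2 * e * g * h) + x ^ 11 * (a * b ^ 2 * d ^ 2 * e * f * g)
        + x ^ 10 * (a * b ^ 2 * d ^ 2 * e * f * h) := by
    linear_combination 2 * (c * d * e * f * g * h) * h1 - (a * c * d ^ 2 * f * g * h) * h2
        - (a * b * c * d ^ 2 * g * h) * h3 - (b ^ 2 * c * d * e * g * h) * h4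
        - (b ^ 2 * c * e * f * g * h) * h5 + (a * b ^ 2 * c * d * e * f * h) * h6
        + (a * b ^ 2 * c * d * f * g * h) * h7 + (a * b ^ 2 * c * d ^ 2 * f * g) * h8
        - (a * b * d * e * f * g * h) * h9 - (a * b ^ 2 * e * f * g * h) * h10
        - (a * b ^ 2 * d * e * g * h) * h11 - (a * b ^ 2 * d ^ 2 * g * h) * h12
        - (a * b * d ^ 2 * f * g * h) * h13 - (b * c * d ^ 2 * e * g * h) * h14
        + (a * b ^ 2 * d ^ 2 * e * g * h) * h15 + (a * b ^ 2 * d ^ 2 * e * f * g) * h16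
        + (a * b ^ 2 * d ^ 2 * e * f * h) * h17
  refine Eq.trans ?_ (key.trans ?_)
  · ring
  · rw [ha, hb, hc, hd, he, hf, hg, hh]
    ring

/-! ### Normalized squares -/

/-- The normalized square with smallest entry `m` that belongs to the quadruple `(f, h, p, q)`. -/
def normalSquare (m f h p q : ℕ) : Matrix (Fin 3) (Fin 3) ℕ :=
  !![m, m + f + h, m + f + h + 2 * p + q;
     m + f + h + p, m + h + p + q, m + f;
     m + f + h + p + q, m + f + p, m + h]

/-- The normalized square with smallest entry `m` that belongs to a quadruple. -/
def Quad.square (m : ℕ) (v : Quad) : Matrix (Fin 3) (Fin 3) ℕ :=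
  normalSquare m (v.1 + 1) (v.2.1 + 1) (v.2.2.1 + 1) (v.2.2.2.1 + 1)

lemma Quad.square_injective {m m' : ℕ} {v v' : Quad} (h : v.square m = v'.square m') :
    m = m' ∧ v = v' := by
  have h0 := congrFun₂ h 0 0
  have h1 := congrFun₂ h 1 2
  have h2 := congrFun₂ h 2 2
  have h3 := congrFun₂ h 2 1
  have h4 := congrFun₂ h 1 1
  simp [Quad.square, normalSquare] at h0 h1 h2 h3 h4
  refine ⟨h0, ?_⟩
  ext <;> omega

lemma Quad.isNormalized_square (m : ℕ) (v : Quad) : IsNormalized (v.square m) := by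
  refine ⟨fun i j => ?_, ?_⟩
  · fin_cases i <;> fin_cases j <;> simp [Quad.square, normalSquare] <;> omega
  · simp [Quad.square, normalSquare]
    omega

lemma Quad.hasDistinctEntriesAndLineSum_square (m : ℕ) {v : Quad} (hv : v.Sat OffHyperplanes) :
    HasDistinctEntriesAndLineSum (3 * m + quadWeight v) (v.square m) := by
  rw [quadWeight_apply]
  simp only [Quad.Sat, OffHyperplanes] at hv
  refine ⟨fun i j k l => ?_, fun i => ?_, fun j => ?_⟩
  · fin_cases i <;> fin_cases j <;> fin_cases k <;> fin_cases l <;>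
      simp [Quad.square, normalSquare] <;> omega
  · fin_cases i <;> simp [Quad.square, normalSquare, Fin.sum_univ_three] <;> omega
  · fin_cases j <;> simp [Quad.square, normalSquare, Fin.sum_univ_three] <;> omega

/-- In a normalized square `x` the parameters are `f = x₂₃ - x₁₁`, `h = x₃₃ - x₁₁`,
`p = x₂₁ - x₁₂` and `q = x₃₁ - x₂₁`. -/
lemma exists_quad_of_isNormalized {t : ℕ} {x : Matrix (Fin 3) (Fin 3) ℕ}
    (hx : HasDistinctEntriesAndLineSum t x) (hn : IsNormalized x) :
    ∃ v : Quad, v.Sat OffHyperplanes ∧ v.square (x 0 0) = x ∧ t = 3 * x 0 0 + quadWeight v := by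
  obtain ⟨hd, hr, hc⟩ := hx
  obtain ⟨hmin, ⟨_, h1⟩, ⟨_, h2⟩, h3⟩ := hn
  have ne : ∀ i j k l, ¬ (i = k ∧ j = l) → x i j ≠ x k l := fun i j k l h e => h (hd i j k l e)
  have m1 : x 0 0 < x 1 2 := lt_of_le_of_ne (hmin 1 2) (ne 0 0 1 2 (by decide))
  have m2 : x 0 0 < x 2 2 := lt_of_le_of_ne (hmin 2 2) (ne 0 0 2 2 (by decide))
  have n1 := ne 1 2 2 2 (by decide)
  have n2 := ne 1 2 1 1 (by decide)
  have n3 := ne 2 1 2 2 (by decide)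
  have n4 := ne 2 1 0 1 (by decide)
  have n5 := ne 2 1 1 1 (by decide)
  have n6 := ne 1 1 0 1 (by decide)
  have n7 := ne 1 1 1 0 (by decide)
  simp only [Fin.sum_univ_three] at hr hc
  have e1 : x 0 1 + x 0 0 = x 1 2 + x 2 2 := by linarith [hr 0, hc 2]
  have e2 : x 0 2 + x 0 1 = x 1 0 + x 2 0 := by linarith [hr 0, hc 0]
  have e3 : x 2 1 + x 0 1 = x 1 0 + x 1 2 := by linarith [hr 1, hc 1]
  have e4 : x 1 1 + x 1 2 = x 0 0 + x 2 0 := by linarith [hr 1, hc 0]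
  have e5 : t = x 0 0 + x 0 1 + x 0 2 := (hr 0).symm
  clear hd hr hc hmin ne
  refine ⟨(x 1 2 - x 0 0 - 1, x 2 2 - x 0 0 - 1, x 1 0 - x 0 1 - 1, x 2 0 - x 1 0 - 1, ()),
    ?_, ?_, ?_⟩
  · simp only [Quad.Sat, OffHyperplanes]
    refine ⟨?_, ?_, ?_, ?_, ?_, ?_, ?_⟩ <;> omega
  · clear n1 n2 n3 n4 n5 n6 n7
    ext i j
    fin_cases i <;> fin_cases j <;> simp [Quad.square, normalSquare] <;> omega
  · clear n1 n2 n3 n4 n5 n6 n7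
    rw [quadWeight_apply]
    dsimp only
    omega

lemma reducedNormalCount_eq_coeff (s : ℕ) :
    (reducedNormalCount s : ℚ) = PowerSeries.coeff s (quadGF OffHyperplanes) := by
  classical
  unfold quadGF Quad.ind
  rw [coeff_weightGF_ite, reducedNormalCount,
    ← Set.ncard_image_of_injective _ (f := Quad.square 0) fun v v' h => (Quad.square_injective h).2]
  congr 2
  ext x
  simp only [Set.mem_ofPred_eq, Set.mem_image]
  constructor
  · rintro ⟨⟨⟨i, j, h0⟩, hx⟩, hn⟩
    obtain ⟨v, hv, hvx, ht⟩ := exists_quad_of_isNormalized hx hn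
    have := hn.1 i j
    have h00 : x 0 0 = 0 := by omega
    rw [h00] at hvx ht
    exact ⟨v, ⟨by omega, hv⟩, hvx⟩
  · rintro ⟨v, ⟨hw, hv⟩, rfl⟩
    have := v.hasDistinctEntriesAndLineSum_square 0 hv
    rw [hw, mul_zero, zero_add] at this
    exact ⟨⟨⟨0, 0, by simp [Quad.square, normalSquare]⟩, this⟩, v.isNormalized_square 0⟩

lemma ncard_semimagic_normalized (t : ℕ) :
    ({x | IsSemimagic t x ∧ IsNormalized x}.ncard : ℚ)
      = PowerSeries.coeff t
          (weightGF (adjoinWeight 3 quadWeight) fun v => Quad.ind OffHyperplanes v.2) := by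
  classical
  unfold Quad.ind
  have hinj : Function.Injective fun v : ℕ × Quad => v.2.square (v.1 + 1) := by
    intro v v' h
    obtain ⟨h1, h2⟩ := Quad.square_injective h
    exact Prod.ext (by omega) h2
  rw [coeff_weightGF_ite, ← Set.ncard_image_of_injective _ hinj]
  congr 2
  ext x
  simp only [Set.mem_ofPred_eq, Set.mem_image, adjoinWeight]
  constructor
  · rintro ⟨⟨hpos, hx⟩, hn⟩
    obtain ⟨v, hv, hvx, ht⟩ := exists_quad_of_isNormalized hx hn
    have h0 := hpos 0 0
    have h1 : x 0 0 - 1 + 1 = x 0 0 := by omega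
    exact ⟨(x 0 0 - 1, v), ⟨by dsimp only; omega, hv⟩, by dsimp only; rw [h1, hvx]⟩
  · rintro ⟨⟨m, v⟩, ⟨hw, hv⟩, rfl⟩
    have h1 := v.hasDistinctEntriesAndLineSum_square (m + 1) hv
    have h2 := v.isNormalized_square (m + 1)
    rw [hw] at h1
    refine ⟨⟨fun i j => lt_of_lt_of_le ?_ (h2.1 i j), h1⟩, h2⟩
    simp [Quad.square, normalSquare]

/-! ### The symmetries of a semimagic square -/

/-- If every element of `S` is moved by exactly one of the permutations `e k` of the ambient type,
all of which preserve `S`, into the part of `S` where `P` holds, then `S` has as many elements as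
`K` copies of that part. -/
lemma ncard_eq_card_mul_ncard {α K : Type*} [Fintype K] (S : Set α) (P : α → Prop) (e : K → α ≃ α)
    (hS : ∀ k x, e k x ∈ S ↔ x ∈ S) (hP : ∀ x ∈ S, ∃! k, P (e k x)) :
    S.ncard = Fintype.card K * {x | x ∈ S ∧ P x}.ncard := by
  have h1 : S.ncard = Nat.card (K × {x | x ∈ S ∧ P x}) := by
    rw [← Nat.card_coe_set_eq]
    symm
    refine Nat.card_eq_of_bijective (fun v => ⟨(e v.1).symm v.2, ?_⟩) ⟨?_, ?_⟩
    · rw [← hS v.1, Equiv.apply_symm_apply]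
      exact v.2.2.1
    · rintro ⟨k, x, hx, hx'⟩ ⟨l, y, hy, hy'⟩ h
      simp only [Subtype.mk.injEq] at h
      have hmem : (e k).symm x ∈ S := by
        rwa [← hS k, Equiv.apply_symm_apply]
      have hkl : k = l := by
        refine (hP _ hmem).unique ?_ ?_
        · rwa [Equiv.apply_symm_apply]
        · rwa [h, Equiv.apply_symm_apply]
      subst hkl
      have : x = y := (e k).symm.injective h
      subst this
      rfl
    · rintro ⟨x, hx⟩
      obtain ⟨k, hk, _⟩ := hP x hx
      exact ⟨(k, ⟨e k x, (hS k x).2 hx, hk⟩), by simp⟩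
  rw [h1, Nat.card_prod, Nat.card_eq_fintype_card, Nat.card_coe_set_eq]

/-- Permuting the rows and the columns. -/
def permuteLines (σ τ : Equiv.Perm (Fin 3)) :
    Matrix (Fin 3) (Fin 3) ℕ ≃ Matrix (Fin 3) (Fin 3) ℕ := Matrix.reindex σ.symm τ.symm

lemma permuteLines_apply (σ τ : Equiv.Perm (Fin 3)) (x : Matrix (Fin 3) (Fin 3) ℕ) (i j : Fin 3) :
    permuteLines σ τ x i j = x (σ i) (τ j) := by
  simp [permuteLines]

lemma isSemimagic_permuteLines (σ τ : Equiv.Perm (Fin 3)) {t : ℕ}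
    (x : Matrix (Fin 3) (Fin 3) ℕ) : IsSemimagic t (permuteLines σ τ x) ↔ IsSemimagic t x := by
  have key : ∀ (σ τ : Equiv.Perm (Fin 3)) (x : Matrix (Fin 3) (Fin 3) ℕ),
      IsSemimagic t x → IsSemimagic t (permuteLines σ τ x) := by
    rintro σ τ x ⟨h0, h1, h2, h3⟩
    refine ⟨fun i j => ?_, fun i j k l h => ?_, fun i => ?_, fun j => ?_⟩
    · rw [permuteLines_apply]
      exact h0 _ _
    · rw [permuteLines_apply, permuteLines_apply] at h
      simpa using h1 _ _ _ _ h
    · simp only [permuteLines_apply]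
      rw [Equiv.sum_comp τ (fun j => x (σ i) j)]
      exact h2 _
    · simp only [permuteLines_apply]
      rw [Equiv.sum_comp σ (fun i => x i (τ j))]
      exact h3 _
  refine ⟨fun h => ?_, key σ τ x⟩
  convert key σ.symm τ.symm _ h
  ext i j
  simp [permuteLines_apply]

/-- Transposition, as a permutation of the squares. -/
def transposeEquiv : Matrix (Fin 3) (Fin 3) ℕ ≃ Matrix (Fin 3) (Fin 3) ℕ :=
  ⟨Matrix.transpose, Matrix.transpose, Matrix.transpose_transpose, Matrix.transpose_transpose⟩

lemma isSemimagic_transpose {t : ℕ} (x : Matrix (Fin 3) (Fin 3) ℕ) :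
    IsSemimagic t x.transpose ↔ IsSemimagic t x := by
  have key : ∀ x : Matrix (Fin 3) (Fin 3) ℕ, IsSemimagic t x → IsSemimagic t x.transpose :=
    fun x ⟨h0, h1, h2, h3⟩ =>
      ⟨fun i j => h0 j i, fun i j k l h => (h1 _ _ _ _ h).symm, h3, h2⟩
  exact ⟨fun h => by simpa using key _ h, key x⟩

/-- An involution that preserves `S` and exchanges the part where `P` holds with the part where it
does not hold shows that `P` holds on half of `S`. -/
lemma ncard_eq_two_mul_ncard {α : Type*} (S : Set α) (P : α → Prop) (e : α ≃ α)
    (hS : ∀ x, e x ∈ S ↔ x ∈ S) (hP : ∀ x ∈ S, P (e x) ↔ ¬ P x) :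
    S.ncard = 2 * {x | x ∈ S ∧ P x}.ncard := by
  refine ncard_eq_card_mul_ncard S P (fun b : Bool => if b then e else Equiv.refl α) ?_ ?_
  · rintro (_ | _) x <;> simp [hS]
  · intro x hx
    by_cases h : P x
    · exact ⟨false, by simpa using h, by rintro (_ | _) <;> simp [hP x hx, h]⟩
    · exact ⟨true, by simpa [hP x hx] using h, by rintro (_ | _) <;> simp [h]⟩

/-- Every semimagic square can be normalized in exactly one way by a permutation of the rows, a
permutation of the columns and possibly a transposition; there are `3 * 3 * 2 * 2 * 2` choices. -/
theorem semimagicCount_eq (t : ℕ) :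
    semimagicCount t = 72 * {x | IsSemimagic t x ∧ IsNormalized x}.ncard := by
  have hne : ∀ {x}, IsSemimagic t x → ∀ i j k l, ¬ (i = k ∧ j = l) → x i j ≠ x k l :=
    fun hx i j k l h e => h (hx.2.1 i j k l e)
  -- Cyclic shifts of rows and columns bring the smallest entry to the upper left corner.
  have s1 := ncard_eq_card_mul_ncard {x | IsSemimagic t x} (fun x => ∀ i j, x 0 0 ≤ x i j)
    (fun k : Fin 3 × Fin 3 => permuteLines (Equiv.addRight k.1) (Equiv.addRight k.2))
    (fun k x => isSemimagic_permuteLines _ _ x) (by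
      intro x hx
      obtain ⟨k, hk⟩ := Finite.exists_min fun k : Fin 3 × Fin 3 => x k.1 k.2
      have hk' : ∀ l : Fin 3 × Fin 3,
          (∀ i j, permuteLines (Equiv.addRight l.1) (Equiv.addRight l.2) x 0 0
            ≤ permuteLines (Equiv.addRight l.1) (Equiv.addRight l.2) x i j)
          ↔ ∀ i j, x l.1 l.2 ≤ x i j := by
        intro l
        simp only [permuteLines_apply, Equiv.coe_addRight, zero_add]
        exact ⟨fun h i j => by simpa using h (i - l.1) (j - l.2), fun h i j => h _ _⟩
      refine ⟨k, (hk' k).2 fun i j => hk (i, j), fun l hl => ?_⟩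
      have h1 := (hk' l).1 hl k.1 k.2
      have h2 := hx.2.1 _ _ _ _ (le_antisymm h1 (hk l))
      exact Prod.ext h2.1 h2.2)
  -- Exchanging the last two columns orders the first row.
  have s2 := ncard_eq_two_mul_ncard {x | IsSemimagic t x ∧ ∀ i j, x 0 0 ≤ x i j}
    (fun x => x 0 1 < x 0 2) (permuteLines 1 (Equiv.swap 1 2))
    (by
      intro x
      simp only [Set.mem_ofPred_eq, isSemimagic_permuteLines, Fin.forall_fin_succ, permuteLines_apply]
      simp [Equiv.swap_apply_def]
      tauto)
    (by
      rintro x ⟨hx, -⟩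
      have := hne hx 0 1 0 2 (by decide)
      simp [permuteLines_apply]
      omega)
  -- Exchanging the last two rows orders the first column.
  have s3 := ncard_eq_two_mul_ncard
    {x | (IsSemimagic t x ∧ ∀ i j, x 0 0 ≤ x i j) ∧ x 0 1 < x 0 2}
    (fun x => x 1 0 < x 2 0) (permuteLines (Equiv.swap 1 2) 1)
    (by
      intro x
      simp only [Set.mem_ofPred_eq, isSemimagic_permuteLines, Fin.forall_fin_succ, permuteLines_apply]
      simp [Equiv.swap_apply_def]
      tauto)
    (by
      rintro x ⟨⟨hx, -⟩, -⟩
      have := hne hx 1 0 2 0 (by decide)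
      simp [permuteLines_apply]
      omega)
  -- Transposition orders the two neighbours of the corner.
  have s4 := ncard_eq_two_mul_ncard
    {x | ((IsSemimagic t x ∧ ∀ i j, x 0 0 ≤ x i j) ∧ x 0 1 < x 0 2) ∧ x 1 0 < x 2 0}
    (fun x => x 0 1 < x 1 0) transposeEquiv
    (by
      intro x
      simp only [transposeEquiv, Equiv.coe_fn_mk, Set.mem_ofPred_eq, isSemimagic_transpose,
        Matrix.transpose_apply]
      rw [forall_comm]
      tauto)
    (by
      rintro x ⟨⟨⟨hx, -⟩, -⟩, -⟩
      have := hne hx 0 1 1 0 (by decide)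
      simp only [transposeEquiv, Equiv.coe_fn_mk, Matrix.transpose_apply]
      omega)
  have s5 : {x | IsSemimagic t x ∧ IsNormalized x}
      = {x | x ∈ {x | ((IsSemimagic t x ∧ ∀ i j, x 0 0 ≤ x i j) ∧ x 0 1 < x 0 2)
          ∧ x 1 0 < x 2 0} ∧ x 0 1 < x 1 0} := by
    ext x
    simp only [Set.mem_ofPred_eq, IsNormalized]
    constructor
    · rintro ⟨hx, h1, ⟨_, h2⟩, ⟨_, h3⟩, h4⟩
      exact ⟨⟨⟨⟨hx, h1⟩, h2⟩, h3⟩, h4⟩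
    · rintro ⟨⟨⟨⟨hx, h1⟩, h2⟩, h3⟩, h4⟩
      have h01 := lt_of_le_of_ne (h1 0 1) (hne hx 0 0 0 1 (by decide))
      exact ⟨hx, h1, ⟨h01, h2⟩, ⟨h01.trans h4, h3⟩, h4⟩
  rw [s5, semimagicCount, s1]
  simp only [Set.mem_ofPred_eq] at s2 s3 s4 ⊢
  rw [s2, s3, s4, Fintype.card_prod, Fintype.card_fin]
  ring

/-- Subtracting the smallest entry: a semimagic square is a reduced one plus a positive constant. -/
theorem genFun_semimagicCount_mul :
    genFun semimagicCount * (1 - PowerSeries.X ^ 3)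
      = 72 * PowerSeries.X ^ 3 * quadGF OffHyperplanes := by
  have h1 : genFun semimagicCount
      = 72 * weightGF (adjoinWeight 3 quadWeight) fun v => Quad.ind OffHyperplanes v.2 := by
    ext t
    rw [show (72 : PowerSeries ℚ) = PowerSeries.C 72 from (map_ofNat _ 72).symm,
      PowerSeries.coeff_C_mul, ← ncard_semimagic_normalized]
    rw [genFun, PowerSeries.coeff_mk]
    split_ifs with ht
    · subst ht
      have : {x | IsSemimagic 0 x ∧ IsNormalized x} = ∅ := by
        ext x
        simp only [Set.mem_ofPred_eq, Set.mem_empty_iff_false, iff_false, not_and]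
        intro hx
        have h1 := hx.1 0 0
        have h2 := hx.2.2.1 0
        rw [Fin.sum_univ_three] at h2
        omega
      rw [this]
      simp
    · rw [semimagicCount_eq]
      push_cast
      rfl
  have h2 := weightGF_adjoin finiteFibres_quadWeight three_pos (Quad.ind OffHyperplanes)
  rw [h1]
  unfold quadGF
  linear_combination 72 * h2

lemma genFun_reducedNormalCount : genFun reducedNormalCount = quadGF OffHyperplanes := by
  ext s
  rw [genFun, PowerSeries.coeff_mk]
  split_ifs with hs
  · subst hs
    rw [quadGF, coeff_weightGF]
    have : {v | quadWeight v = 0} = ∅ := by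
      ext v
      simp only [Set.mem_ofPred_eq, Set.mem_empty_iff_false, iff_false, quadWeight_apply]
      omega
    rw [this, finsum_mem_empty]
  · exact reducedNormalCount_eq_coeff s

/-! ### Iterated differences with several steps -/

/-- The iterated forward difference of `f` with the steps in the list `L`. -/
def fwdDiffs (L : List ℕ) (f : ℕ → ℚ) : ℕ → ℚ := L.foldr fwdDiff f

lemma fwdDiffs_cons (k : ℕ) (L : List ℕ) (f : ℕ → ℚ) (n : ℕ) :
    fwdDiffs (k :: L) f n = fwdDiffs L f (n + k) - fwdDiffs L f n := rfl

lemma fwdDiffs_nil (f : ℕ → ℚ) : fwdDiffs [] f = f := rfl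

lemma fwdDiffs_shift (L : List ℕ) (f : ℕ → ℚ) (j n : ℕ) :
    fwdDiffs L (fun m => f (m + j)) n = fwdDiffs L f (n + j) := by
  induction L generalizing n with
  | nil => rfl
  | cons k L ih => rw [fwdDiffs_cons, fwdDiffs_cons, ih, ih, add_right_comm]

lemma fwdDiffs_sub (L : List ℕ) (f g : ℕ → ℚ) (n : ℕ) :
    fwdDiffs L (fun m => f m - g m) n = fwdDiffs L f n - fwdDiffs L g n := by
  induction L generalizing n with
  | nil => rfl
  | cons k L ih => rw [fwdDiffs_cons, fwdDiffs_cons, fwdDiffs_cons, ih, ih]; ring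

lemma fwdDiffs_append (L M : List ℕ) (f : ℕ → ℚ) :
    fwdDiffs (L ++ M) f = fwdDiffs L (fwdDiffs M f) := by
  simp [fwdDiffs]

lemma fwdDiffs_comm (L M : List ℕ) (f : ℕ → ℚ) :
    fwdDiffs L (fwdDiffs M f) = fwdDiffs M (fwdDiffs L f) := by
  rw [← fwdDiffs_append, ← fwdDiffs_append]
  have : LeftCommutative (fwdDiff : ℕ → (ℕ → ℚ) → ℕ → ℚ) :=
    ⟨fun a b f => by ext n; simp only [fwdDiff, add_right_comm n b a]; ring⟩
  exact List.perm_append_comm.foldr_eq f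

lemma fwdDiffs_eq_zero_of_forall_le (L : List ℕ) {f : ℕ → ℚ} {n : ℕ}
    (h : ∀ m, m ≤ n + L.sum → f m = 0) : fwdDiffs L f n = 0 := by
  induction L generalizing n with
  | nil => exact h n (by simp)
  | cons k L ih =>
    simp only [List.sum_cons] at h
    rw [fwdDiffs_cons, ih fun m hm => h m (by omega), ih fun m hm => h m (by omega), sub_zero]

/-- A sequence that is annihilated by iterated differences is determined by as many initial values
as the sum of the steps. -/
lemma eq_zero_of_fwdDiffs_eq_zero (L : List ℕ) (hL : ∀ k ∈ L, 0 < k) {f : ℕ → ℚ}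
    (h : ∀ n, fwdDiffs L f n = 0) (h0 : ∀ n < L.sum, f n = 0) (n : ℕ) : f n = 0 := by
  induction L generalizing n with
  | nil => exact h n
  | cons k L ih =>
    simp only [List.mem_cons, forall_eq_or_imp, List.sum_cons] at hL h0
    refine ih hL.2 (fun m => ?_) (fun m hm => h0 m (by omega)) n
    induction m using Nat.strong_induction_on with
    | _ m hm =>
      by_cases hmk : m < k
      · exact fwdDiffs_eq_zero_of_forall_le L fun j hj => h0 j (by omega)
      · have h1 := h (m - k)
        rw [fwdDiffs_cons, Nat.sub_add_cancel (not_lt.1 hmk), hm (m - k) (by omega), sub_zero] at h1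
        exact h1

/-- Multiplication by `1 - x ^ k` takes differences of the coefficients. -/
lemma coeff_prod_one_sub_X_pow_mul (L : List ℕ) (φ : PowerSeries ℚ) (n : ℕ) :
    PowerSeries.coeff (n + L.sum) ((L.map fun k => 1 - PowerSeries.X ^ k).prod * φ)
      = fwdDiffs L (fun m => PowerSeries.coeff m φ) n := by
  induction L generalizing n with
  | nil => simp [fwdDiffs]
  | cons k L ih =>
    rw [fwdDiffs_cons, ← ih, ← ih, List.map_cons, List.prod_cons, List.sum_cons, mul_assoc, sub_mul,
      one_mul, map_sub, PowerSeries.coeff_X_pow_mul', if_pos (by omega)]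
    congr 2 <;> congr 1 <;> omega

/-- Differences of finite lists. -/
def listDiffs (L : List ℕ) (l : List ℚ) : List ℚ :=
  L.foldr (fun k l => List.zipWith (· - ·) (l.drop k) l) l

lemma listDiffs_map_range (L : List ℕ) (f : ℕ → ℚ) (n : ℕ) :
    listDiffs L ((List.range (n + L.sum)).map f) = (List.range n).map (fwdDiffs L f) := by
  induction L generalizing n with
  | nil => simp [listDiffs, fwdDiffs]
  | cons k L ih =>
    have h : listDiffs (k :: L) ((List.range (n + (k :: L).sum)).map f)
      = List.zipWith (· - ·) ((listDiffs L ((List.range (n + k + L.sum)).map f)).drop k)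
        (listDiffs L ((List.range (n + k + L.sum)).map f)) := by
      rw [List.sum_cons, ← add_assoc]
      rfl
    rw [h, ih]
    apply List.ext_getElem
    · simp
    · intro i h1 h2
      simp [fwdDiffs_cons, add_comm]

/-! ### The explicit formula -/

/-- The part of the explicit formula with coefficients of period `120`. -/
def mainPart (t : ℕ) : ℚ :=
  1 / 8 * (t : ℚ) ^ 4 - 9 / 2 * (t : ℚ) ^ 3 + coeffA2 t * (t : ℚ) ^ 2 - coeffA1 t * (t : ℚ)
    + coeffA0 t

/-- The explicit formula for the number of semimagic squares. -/
def explicitCount (t : ℕ) : ℚ := mainPart t - 72 * (correctionS7 t : ℚ)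

lemma coeffA2_add (t j : ℕ) : coeffA2 (t + 6 * j) = coeffA2 t := by
  simp [coeffA2]

lemma coeffA1_add (t j : ℕ) : coeffA1 (t + 12 * j) = coeffA1 t := by
  simp [coeffA1]

lemma coeffA0_add (t j : ℕ) : coeffA0 (t + 120 * j) = coeffA0 t := by
  simp [coeffA0]

lemma correctionS7_add (t j : ℕ) : correctionS7 (t + 21 * j) = correctionS7 t + j := by
  have h : ((t + 21 * j : ℕ) : ℤ) - 1 = t - 1 + j * 21 := by push_cast; ring
  rw [correctionS7, correctionS7, h, Int.add_mul_ediv_right _ _ (by norm_num),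
    Nat.add_mul_mod_self_left]
  ring

/-- The difference with step `120` removes `coeffA0`, the one with step `12` removes `coeffA1`, and
the one with step `6` removes `coeffA2`; a polynomial of degree `1` remains. -/
lemma fwdDiffs_mainPart (t : ℕ) : fwdDiffs [1, 1, 6, 12, 120] mainPart t = 0 := by
  have h1 : ∀ t : ℕ, fwdDiffs [120] mainPart t
      = 60 * (t : ℚ) ^ 3 + 9180 * (t : ℚ) ^ 2 + 669600 * t + 18144000
        + coeffA2 t * (240 * t + 14400) - 120 * coeffA1 t := by
    intro t
    have e2 : coeffA2 (t + 120) = coeffA2 t := coeffA2_add t 20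
    have e1 : coeffA1 (t + 120) = coeffA1 t := coeffA1_add t 10
    have e0 : coeffA0 (t + 120) = coeffA0 t := coeffA0_add t 1
    rw [fwdDiffs_cons, fwdDiffs_nil, mainPart, mainPart, e2, e1, e0]
    push_cast
    ring
  have h2 : ∀ t : ℕ, fwdDiffs [12, 120] mainPart t
      = 2160 * (t : ℚ) ^ 2 + 246240 * t + 9460800 + 2880 * coeffA2 t := by
    intro t
    have e2 : coeffA2 (t + 12) = coeffA2 t := coeffA2_add t 2
    have e1 : coeffA1 (t + 12) = coeffA1 t := coeffA1_add t 1
    rw [fwdDiffs_cons, h1, h1, e2, e1]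
    push_cast
    ring
  have h3 : ∀ t : ℕ, fwdDiffs [6, 12, 120] mainPart t = 25920 * t + 1555200 := by
    intro t
    have e2 : coeffA2 (t + 6) = coeffA2 t := coeffA2_add t 1
    rw [fwdDiffs_cons, h2, h2, e2]
    push_cast
    ring
  have h4 : ∀ t : ℕ, fwdDiffs [1, 6, 12, 120] mainPart t = 25920 := by
    intro t
    rw [fwdDiffs_cons, h3, h3]
    push_cast
    ring
  rw [fwdDiffs_cons, h4, h4, sub_self]

lemma fwdDiffs_correctionS7 (t : ℕ) :
    fwdDiffs [1, 21] (fun t => 72 * (correctionS7 t : ℚ)) t = 0 := by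
  have h : ∀ t, fwdDiffs [21] (fun t => 72 * (correctionS7 t : ℚ)) t = 72 := by
    intro t
    have e : correctionS7 (t + 21) = correctionS7 t + 1 := correctionS7_add t 1
    rw [fwdDiffs_cons, fwdDiffs_nil, e]
    push_cast
    ring
  rw [fwdDiffs_cons, h, h, sub_self]

/-- The numbers `0, …, 0, explicitCount 1, explicitCount 2, …`, beginning with `37` zeros: the
coefficients of `x ^ 36` times the generating function of `explicitCount` on positive integers. -/
def paddedCount (n : ℕ) : ℚ := if n ≤ 36 then 0 else explicitCount (n - 36)

/-- The coefficients of the numerator of the generating function. -/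
def numeratorCoeffs : List ℚ :=
  List.replicate 15 0 ++ [1, 2, 4, 6, 7, 9, 7, 7, -3, 1, -16, -9, -22, -13, -23, 1, -8, 11, 0, 15,
    5, 18].map (72 * ·)

/-- The finite computation behind the explicit formula. The `36` zeros by which `paddedCount` is
shifted make its differences the coefficients of the product with the denominator: first the `37`
coefficients of the numerator, and then `162 = 1 + 21 + 1 + 1 + 6 + 12 + 120` zeros. -/
lemma listDiffs_paddedCount :
    listDiffs [3, 3, 4, 5, 6, 7, 8] ((List.range (199 + 36)).map paddedCount)
      = numeratorCoeffs ++ List.replicate 162 0 := by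
  decide +kernel

lemma fwdDiffs_paddedCount_of_lt {n : ℕ} (hn : n < 199) :
    fwdDiffs [3, 3, 4, 5, 6, 7, 8] paddedCount n
      = (numeratorCoeffs ++ List.replicate 162 0).getD n 0 := by
  have h := listDiffs_map_range [3, 3, 4, 5, 6, 7, 8] paddedCount 199
  rw [← listDiffs_paddedCount]
  change listDiffs [3, 3, 4, 5, 6, 7, 8] ((List.range (199 + 36)).map paddedCount) = _ at h
  rw [h, List.getD_eq_getElem _ _ (by simpa using hn)]
  simp

lemma fwdDiffs_fwdDiffs_explicitCount (t : ℕ) :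
    fwdDiffs ([1, 21] ++ [1, 1, 6, 12, 120]) (fwdDiffs [3, 3, 4, 5, 6, 7, 8] explicitCount) t
      = 0 := by
  have h : fwdDiffs ([1, 21] ++ [1, 1, 6, 12, 120]) explicitCount = fun _ => 0 := by
    funext t
    have h1 : fwdDiffs [1, 1, 6, 12, 120] mainPart = fun _ => 0 := funext fwdDiffs_mainPart
    have h2 : fwdDiffs [1, 21] (fun t => 72 * (correctionS7 t : ℚ)) = fun _ => 0 :=
      funext fwdDiffs_correctionS7
    have h0 : ∀ L, fwdDiffs L (fun _ => 0) t = 0 := fun L =>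
      fwdDiffs_eq_zero_of_forall_le L fun _ _ => rfl
    rw [show explicitCount = fun t => mainPart t - 72 * (correctionS7 t : ℚ) from rfl,
      fwdDiffs_sub, fwdDiffs_append, h1, fwdDiffs_append, fwdDiffs_comm, h2, h0, h0, sub_zero]
  rw [fwdDiffs_comm, h]
  exact fwdDiffs_eq_zero_of_forall_le _ fun _ _ => rfl

lemma fwdDiffs_paddedCount (n : ℕ) :
    fwdDiffs [3, 3, 4, 5, 6, 7, 8] paddedCount n = numeratorCoeffs.getD n 0 := by
  have hlen : numeratorCoeffs.length = 37 := rfl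
  by_cases hn : n < 37
  · rw [fwdDiffs_paddedCount_of_lt (by omega), List.getD_append _ _ _ _ (by omega)]
  · obtain ⟨m, rfl⟩ : ∃ m, n = m + 37 := ⟨n - 37, by omega⟩
    rw [List.getD_eq_default _ _ (by omega)]
    have hs : (fun m => paddedCount (m + 37)) = fun m => explicitCount (m + 1) := by
      funext m
      rw [paddedCount, if_neg (by omega)]
      rfl
    refine eq_zero_of_fwdDiffs_eq_zero ([1, 21] ++ [1, 1, 6, 12, 120]) (by decide)
      (f := fun m => fwdDiffs [3, 3, 4, 5, 6, 7, 8] paddedCount (m + 37)) (fun k => ?_)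
      (fun k hk => ?_) m
    · have h : (fun m => fwdDiffs [3, 3, 4, 5, 6, 7, 8] paddedCount (m + 37))
          = fun m => fwdDiffs [3, 3, 4, 5, 6, 7, 8] explicitCount (m + 1) := by
        funext m
        rw [← fwdDiffs_shift, hs, fwdDiffs_shift]
      rw [h, fwdDiffs_shift, fwdDiffs_fwdDiffs_explicitCount]
    · have hk' : k < 162 := hk
      change fwdDiffs [3, 3, 4, 5, 6, 7, 8] paddedCount (k + 37) = 0
      rw [fwdDiffs_paddedCount_of_lt (by omega), List.getD_append_right _ _ _ _ (by omega),
        List.getD_eq_getElem?_getD, List.getElem?_replicate]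
      split_ifs <;> rfl

/-! ### The generating function in closed form and the explicit formula -/

/-- The denominator, of degree `36`, of the generating function of the semimagic squares. -/
noncomputable def gfDenom : ℚ[X] :=
  (1 - X ^ 3) ^ 2 * (1 - X ^ 4) * (1 - X ^ 5) * (1 - X ^ 6) * (1 - X ^ 7) * (1 - X ^ 8)

/-- The numerator of the generating function of the semimagic squares. -/
noncomputable def gfNum : ℚ[X] :=
  72 * X ^ 15 *
    (18 * X ^ 21 + 5 * X ^ 20 + 15 * X ^ 19 + 11 * X ^ 17 - 8 * X ^ 16 + X ^ 15
      - 23 * X ^ 14 - 13 * X ^ 13 - 22 * X ^ 12 - 9 * X ^ 11 - 16 * X ^ 10 + X ^ 9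
      - 3 * X ^ 8 + 7 * X ^ 7 + 7 * X ^ 6 + 9 * X ^ 5 + 7 * X ^ 4 + 6 * X ^ 3
      + 4 * X ^ 2 + 2 * X + 1)

lemma coe_gfDenom : (gfDenom : PowerSeries ℚ)
    = ([3, 3, 4, 5, 6, 7, 8].map fun k : ℕ => (1 - PowerSeries.X ^ k : PowerSeries ℚ)).prod := by
  simp only [gfDenom, Polynomial.coe_mul, Polynomial.coe_pow, Polynomial.coe_sub, Polynomial.coe_one,
    Polynomial.coe_X, List.map_cons, List.map_nil, List.prod_cons, List.prod_nil]
  ring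

lemma constantCoeff_gfDenom : PowerSeries.constantCoeff (gfDenom : PowerSeries ℚ) = 1 := by
  simp [coe_gfDenom]

theorem genFun_semimagicCount_mul_gfDenom :
    genFun semimagicCount * (gfDenom : PowerSeries ℚ) = (gfNum : PowerSeries ℚ) := by
  have h1 := genFun_semimagicCount_mul
  have h2 := quadGF_offHyperplanes_mul
  have hnat : ∀ n : ℕ, [n.AtLeastTwo] →
      (((OfNat.ofNat n : ℚ[X])) : PowerSeries ℚ) = OfNat.ofNat n :=
    fun n _ => map_ofNat Polynomial.coeToPowerSeries.ringHom n
  rw [coe_gfDenom]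
  simp only [gfNum, Polynomial.coe_add, Polynomial.coe_sub, Polynomial.coe_mul, Polynomial.coe_pow,
    Polynomial.coe_X, Polynomial.coe_one, hnat, List.map_cons, List.map_nil, List.prod_cons,
    List.prod_nil]
  linear_combination ((1 - PowerSeries.X ^ 3) * (1 - PowerSeries.X ^ 4)
        * (1 - PowerSeries.X ^ 5) * (1 - PowerSeries.X ^ 6) * (1 - PowerSeries.X ^ 7)
        * (1 - PowerSeries.X ^ 8)) * h1 + 72 * PowerSeries.X ^ 3 * h2

lemma coeff_gfNum (n : ℕ) : gfNum.coeff n = numeratorCoeffs.getD n 0 := by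
  have h : gfNum = ∑ i ∈ Finset.range 37, C (numeratorCoeffs.getD i 0) * X ^ i := by
    simp only [gfNum, numeratorCoeffs, Finset.sum_range_succ, Finset.range_zero, Finset.sum_empty,
      List.replicate, List.map_cons, List.map_nil, List.cons_append, List.nil_append,
      List.getD_cons_succ, List.getD_cons_zero, map_mul, map_neg, map_ofNat, map_zero, map_one]
    ring
  have hlen : numeratorCoeffs.length = 37 := rfl
  rw [h, Polynomial.finsetSum_coeff]
  simp only [Polynomial.coeff_C_mul_X_pow]
  rw [Finset.sum_ite_eq]
  split_ifs with hn
  · rfl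
  · rw [List.getD_eq_default _ _ (by rw [Finset.mem_range] at hn; omega)]

theorem semimagicCount_eq_explicitCount {t : ℕ} (ht : 0 < t) :
    (semimagicCount t : ℚ) = explicitCount t := by
  -- The generating function of the formula has the same product with the denominator.
  have hE : (PowerSeries.mk fun t => if t = 0 then 0 else explicitCount t)
      * (gfDenom : PowerSeries ℚ) = (gfNum : PowerSeries ℚ) := by
    ext n
    have h := coeff_prod_one_sub_X_pow_mul [3, 3, 4, 5, 6, 7, 8]
      (PowerSeries.X ^ 36 * PowerSeries.mk fun t => if t = 0 then 0 else explicitCount t) n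
    have hp : (fun m => PowerSeries.coeff m (PowerSeries.X ^ 36 *
        PowerSeries.mk fun t => if t = 0 then 0 else explicitCount t)) = paddedCount := by
      funext m
      rw [PowerSeries.coeff_X_pow_mul', paddedCount, PowerSeries.coeff_mk]
      split_ifs <;> first | rfl | omega
    rw [hp, fwdDiffs_paddedCount, ← coe_gfDenom, mul_left_comm,
      show [3, 3, 4, 5, 6, 7, 8].sum = 36 from rfl, PowerSeries.coeff_X_pow_mul] at h
    rw [mul_comm, h, Polynomial.coeff_coe, coeff_gfNum]
  have hne : (gfDenom : PowerSeries ℚ) ≠ 0 := by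
    intro h
    simpa [h] using constantCoeff_gfDenom
  have h := mul_right_cancel₀ hne (genFun_semimagicCount_mul_gfDenom.trans hE.symm)
  have h2 := congrArg (PowerSeries.coeff t) h
  rwa [genFun, PowerSeries.coeff_mk, PowerSeries.coeff_mk, if_neg ht.ne', if_neg ht.ne'] at h2

/-! ### Constituents -/

/-- The constituent of the residue class of `r`: on it, `correctionS7 t` grows by `1` every `21`
steps. -/
noncomputable def constituent (r : ℕ) : ℚ[X] :=
  C (1 / 8) * X ^ 4 - C (9 / 2) * X ^ 3 + C (coeffA2 r) * X ^ 2 - C (coeffA1 r + 24 / 7) * X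
    + C (coeffA0 r + 24 / 7 * r - 72 * correctionS7 r)

lemma areConstituents_constituent : AreConstituents semimagicCount 840 constituent := by
  intro t ht
  rw [semimagicCount_eq_explicitCount ht]
  have e2 := coeffA2_add (t % 840) (140 * (t / 840))
  have e1 := coeffA1_add (t % 840) (70 * (t / 840))
  have e0 := coeffA0_add (t % 840) (7 * (t / 840))
  have e7 := correctionS7_add (t % 840) (40 * (t / 840))
  rw [show t % 840 + 6 * (140 * (t / 840)) = t by omega] at e2
  rw [show t % 840 + 12 * (70 * (t / 840)) = t by omega] at e1
  rw [show t % 840 + 120 * (7 * (t / 840)) = t by omega] at e0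
  rw [show t % 840 + 21 * (40 * (t / 840)) = t by omega] at e7
  have ht' : (t : ℚ) = (t % 840 : ℕ) + 840 * (t / 840 : ℕ) := by
    exact_mod_cast (Nat.mod_add_div t 840).symm
  have e7' : (correctionS7 t : ℚ) = correctionS7 (t % 840) + 40 * (t / 840 : ℕ) := by
    rw [e7, Int.cast_add, Int.cast_natCast, Nat.cast_mul, Nat.cast_ofNat]
  simp only [explicitCount, mainPart, constituent, eval_add, eval_sub, eval_mul, eval_C, eval_pow,
    eval_X]
  rw [e2, e1, e0, e7']
  linear_combination (24 / 7 : ℚ) * ht'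

/-- Two polynomials that agree along an arithmetic progression are equal. -/
lemma eq_of_eval_arithProg {p q : ℚ[X]} {a d : ℕ} (hd : 0 < d)
    (h : ∀ k : ℕ, p.eval ((a + d * k : ℕ) : ℚ) = q.eval ((a + d * k : ℕ) : ℚ)) : p = q := by
  refine Polynomial.eq_of_infinite_eval_eq p q ?_
  refine (Set.infinite_range_of_injective (f := fun k : ℕ => ((a + d * k : ℕ) : ℚ)) ?_).mono ?_
  · intro k l hkl
    have h1 : a + d * k = a + d * l := Nat.cast_injective hkl
    exact Nat.eq_of_mul_eq_mul_left hd (by omega)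
  · rintro _ ⟨k, rfl⟩
    exact h k

/-- If `N` and `M` are constituents of the same function modulo `p` and modulo `q`, those that are
used at a common argument are equal. -/
lemma AreConstituents.eq {f : ℕ → ℕ} {p q : ℕ} {N M : ℕ → ℚ[X]} (hp : 0 < p) (hq : 0 < q)
    (hN : AreConstituents f p N) (hM : AreConstituents f q M) (t : ℕ) :
    N (t % p) = M (t % q) := by
  refine eq_of_eval_arithProg (a := t + p * q) (Nat.mul_pos hp hq) fun k => ?_
  have hpos := Nat.mul_pos hp hq
  have h1 : (t + p * q + p * q * k) % p = t % p := by
    rw [show t + p * q + p * q * k = t + p * (q + q * k) by ring, Nat.add_mul_mod_self_left]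
  have h2 : (t + p * q + p * q * k) % q = t % q := by
    rw [show t + p * q + p * q * k = t + q * (p + p * k) by ring, Nat.add_mul_mod_self_left]
  have h3 := hN (t + p * q + p * q * k) (by omega)
  have h4 := hM (t + p * q + p * q * k) (by omega)
  rw [h1] at h3
  rw [h2] at h4
  rw [← h3, ← h4]

lemma constituent_zero : constituent 0 = C (1 / 8) * X ^ 4 - C (9 / 2) * X ^ 3
    + C (243 / 4) * X ^ 2 - C (13896 / 35) * X + C 1296 := by
  have h0 : coeffA0 0 = 1224 := rfl
  have h1 : coeffA1 0 = 1968 / 5 := rfl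
  have h2 : coeffA2 0 = 243 / 4 := rfl
  have h7 : correctionS7 0 = -1 := rfl
  rw [constituent, h0, h1, h2, h7]
  norm_num

lemma natDegree_constituent (r : ℕ) : (constituent r).natDegree = 4 := by
  unfold constituent
  compute_degree!

/-- The linear coefficients show that the index is divisible by `12`; the constant term `1296` of the
principal constituent then singles it out. -/
lemma constituent_ne_constituent_zero {r : ℕ} (h0 : 0 < r) (hr : r < 840) :
    constituent r ≠ constituent 0 := by
  intro h
  have hc0 : ∀ r, (constituent r).coeff 0 = coeffA0 r + 24 / 7 * r - 72 * correctionS7 r := by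
    intro r
    simp [constituent]
  have hc1 : ∀ r, (constituent r).coeff 1 = -(coeffA1 r + 24 / 7) := by
    intro r
    simp [constituent, Polynomial.coeff_C]
  have h1 : coeffA1 r = coeffA1 0 := by
    have := congrArg (fun p => Polynomial.coeff p 1) h
    simp only [hc1] at this
    linarith
  have h2 := congrArg (fun p => Polynomial.coeff p 0) h
  simp only [hc0] at h2
  have k1 : ∀ s < 12, coeffA1 s = coeffA1 0 → s = 0 := by
    decide +kernel
  have k2 : ∀ j < 70, coeffA0 (12 * j) + 24 / 7 * (12 * j : ℕ) - 72 * correctionS7 (12 * j)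
      = coeffA0 0 + 24 / 7 * (0 : ℕ) - 72 * correctionS7 0 → j = 0 := by
    decide +kernel
  have h3 : r % 12 = 0 := by
    refine k1 _ (Nat.mod_lt _ (by norm_num)) ?_
    rw [← h1, ← coeffA1_add (r % 12) (r / 12), Nat.mod_add_div]
  obtain ⟨j, rfl⟩ : ∃ j, r = 12 * j := ⟨r / 12, by omega⟩
  have := k2 j (by omega) h2
  omega

lemma isQuasipolynomialOfPeriod_semimagicCount :
    IsQuasipolynomialOfPeriod semimagicCount 840 := by
  refine ⟨⟨by norm_num, constituent, areConstituents_constituent⟩, ?_⟩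
  rintro q ⟨hq, N, hN⟩
  by_contra hlt
  have h1 := hN.eq hq (by norm_num) areConstituents_constituent 0
  have h2 := hN.eq hq (by norm_num) areConstituents_constituent q
  rw [Nat.mod_self] at h2
  rw [Nat.zero_mod, h2, Nat.zero_mod, Nat.mod_eq_of_lt (not_le.1 hlt)] at h1
  exact constituent_ne_constituent_zero hq (not_le.1 hlt) h1

theorem mainTheorem4 :
    -- the generating function, through reduced normalized squares and in closed form
    (genFun semimagicCount =
        72 * (PowerSeries.X ^ 3 * (1 - PowerSeries.X ^ 3)⁻¹) * genFun reducedNormalCount) ∧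
    (genFun semimagicCount =
      ((72 * X ^ 15 *
        (18 * X ^ 21 + 5 * X ^ 20 + 15 * X ^ 19 + 11 * X ^ 17 - 8 * X ^ 16 + X ^ 15
          - 23 * X ^ 14 - 13 * X ^ 13 - 22 * X ^ 12 - 9 * X ^ 11 - 16 * X ^ 10 + X ^ 9
          - 3 * X ^ 8 + 7 * X ^ 7 + 7 * X ^ 6 + 9 * X ^ 5 + 7 * X ^ 4 + 6 * X ^ 3
          + 4 * X ^ 2 + 2 * X + 1) : ℚ[X]) : PowerSeries ℚ) *
      (((1 - X ^ 3) ^ 2 * (1 - X ^ 4) * (1 - X ^ 5) * (1 - X ^ 6) * (1 - X ^ 7)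
          * (1 - X ^ 8) : ℚ[X]) : PowerSeries ℚ)⁻¹) ∧
    -- the period
    IsQuasipolynomialOfPeriod semimagicCount 840 ∧
    -- the explicit form
    (∀ t : ℕ, 0 < t →
      (semimagicCount t : ℚ) =
        1 / 8 * (t : ℚ) ^ 4 - 9 / 2 * (t : ℚ) ^ 3 + coeffA2 t * (t : ℚ) ^ 2 - coeffA1 t * (t : ℚ)
          + coeffA0 t - 72 * (correctionS7 t : ℚ)) ∧
    -- the degree of the constituents, and the principal constituent
    (∀ N : ℕ → ℚ[X], AreConstituents semimagicCount 840 N →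
      (∀ r < 840, (N r).natDegree = 4) ∧
      N 0 = C (1 / 8) * X ^ 4 - C (9 / 2) * X ^ 3 + C (243 / 4) * X ^ 2
        - C (13896 / 35) * X + C 1296) := by
  have hX : PowerSeries.constantCoeff (1 - PowerSeries.X ^ 3 : PowerSeries ℚ) ≠ 0 := by simp
  have hN : ∀ N : ℕ → ℚ[X], AreConstituents semimagicCount 840 N →
      ∀ r < 840, N r = constituent r := by
    intro N hN r hr
    have h := hN.eq (by norm_num) (by norm_num) areConstituents_constituent r
    rwa [Nat.mod_eq_of_lt hr] at h
  refine ⟨?_, ?_, isQuasipolynomialOfPeriod_semimagicCount, fun t ht => ?_,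
    fun N h => ⟨fun r hr => ?_, ?_⟩⟩
  · have h : genFun semimagicCount
        = 72 * PowerSeries.X ^ 3 * quadGF OffHyperplanes * (1 - PowerSeries.X ^ 3)⁻¹ :=
      (PowerSeries.eq_mul_inv_iff_mul_eq hX).2 genFun_semimagicCount_mul
    rw [h, genFun_reducedNormalCount]
    ring
  · exact (PowerSeries.eq_mul_inv_iff_mul_eq (by
      change PowerSeries.constantCoeff (gfDenom : PowerSeries ℚ) ≠ 0
      rw [constantCoeff_gfDenom]
      exact one_ne_zero)).2 genFun_semimagicCount_mul_gfDenom
  · rw [semimagicCount_eq_explicitCount ht, explicitCount, mainPart]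
  · rw [hN N h r hr, natDegree_constituent]
  · rw [hN N h 0 (by norm_num), constituent_zero]
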